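/- Let $C_1,C_2$ be real symmetric $3\times3$ matrices such that (i) $(x,y,0)\,C_i\,(x,y,0)^T>0$ for all $(x,y)\ne(0,0)$ and $\det C_i<0$ for $i=1,2$; (ii) $C_1^{-1}C_2$ has three distinct positive eigenvalues $\lambda_1>\lambda_2>\lambda_3>0$; (iii) $u^TC_1u<0$ whenever $u\in\mathbb R^3\setminus\{0\}$ and $u^TC_2u=0$. For $\nu=(\nu_1,\nu_2)\in\mathbb R^2$ put $C_\nu=\nu_1C_1+\nu_2C_2$ and, with $u=(x,y,1)^T$, $$\mathcal C_\nu=\{(x,y)\in\mathbb R^2:u^TC_\nu u=0\},\qquad \mathrm{Int}(\mathcal C_\nu)=\{(x,y)\in\mathbb R^2:u^TC_\nu u<0\};$$ let $\mathcal C_1=\mathcal C_{(1,0)}$ be the ellipse of the matrix $C_1$. Call $\nu$ valid if $\nu_2>0$ and $\nu_1+\lambda_3\nu_2>0$; then $\mathcal C_\nu$ is an ellipse inside $\mathcal C_1$. For valid $\nu$ let $P_\nu:\mathcal C_1\to\mathcal C_1$ be the Poncelet map: $P_\nu(z_0)$ is the unique point $z_1\in\mathcal C_1$ such that the segment from $z_0$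 to $z_1$ is tangent to $\mathcal C_\nu$ with $\mathcal C_\nu$ on the left when moving from $z_0$ to $z_1$. Let $\rho(\nu)\in[0,1)$ be the rotation number of the circle map $P_\nu$, where $\mathcal C_1$ is identified with $\mathbb R/\mathbb Z$ in the counterclockwise sense. Let $\nu$ and $\mu$ be valid. Then $\rho(\nu)$ and $\rho(\mu)$ are given by $$\rho(\nu)=\frac{F(\omega(\nu),e)}{2K(e)},\qquad \omega(\nu)=\arcsin\sqrt{\frac{(\lambda_1-\lambda_3)\nu_2}{\lambda_1\nu_2+\nu_1}},\qquad e=\sqrt{\frac{\lambda_1-\lambda_2}{\lambda_1-\lambda_3}},$$ and the same formula with $\mu$ in place of $\nu$, where $F(\phi,e)=\int_0^\phi\frac{d\tau}{\sqrt{1-e^2\sin^2\tau}}$ and $K(e)=F(\tfrac\pi2,e)$; and the following are equivalent: 1. $\mathcal C_\mu\subset\mathrm{Int}(\mathcal C_\nu)$; 2. $\nu\times\mu:=\nu_1\mu_2-\nu_2\mu_1>0$; 3. $\rho(\mu)>\rho(\nu)$. So the rotation number strictly increases as the caustic shrinks within the pencil. -/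

import Mathlib

open scoped Matrix

noncomputable section

namespace Poncelet

/-- The affine plane. -/
abbrev Plane : Type := ℝ × ℝ

/-- The planar cross product `a₁ b₂ - a₂ b₁`. -/
def cross (a b : ℝ × ℝ) : ℝ := a.1 * b.2 - a.2 * b.1

/-- The quadratic form `uᵀ C u`. -/
def quad (C : Matrix (Fin 3) (Fin 3) ℝ) (u : Fin 3 → ℝ) : ℝ := u ⬝ᵥ (C *ᵥ u)

/-- The homogeneous coordinates `(x, y, 1)` of a point of the plane. -/
def homog (z : Plane) : Fin 3 → ℝ := ![z.1, z.2, 1]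

/-- The conic `{(x, y) : uᵀ C u = 0, u = (x, y, 1)}`. -/
def conic (C : Matrix (Fin 3) (Fin 3) ℝ) : Set Plane := {z | quad C (homog z) = 0}

/-- The interior `{(x, y) : uᵀ C u < 0, u = (x, y, 1)}` of the conic of `C`
(for `C` of ordered signature `(+, +, -)`). -/
def conicInt (C : Matrix (Fin 3) (Fin 3) ℝ) : Set Plane := {z | quad C (homog z) < 0}

/-- Ordered signature `(+, +, -)`: a symmetric matrix with positive definite upper-left
`2 × 2` block and negative determinant. -/
structure OrderedSignature (C : Matrix (Fin 3) (Fin 3) ℝ) : Prop where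
  symm : C.IsSymm
  pos : ∀ x y : ℝ, (x, y) ≠ (0, 0) → 0 < quad C ![x, y, 0]
  det_neg : C.det < 0

/-- The standing assumptions on a pair `(C₁, C₂)` representing nested ellipses; the three distinct
positive eigenvalues of `C₁⁻¹ C₂` are listed in decreasing order as `l₁ > l₂ > l₃ > 0`. -/
structure StandingAssumptions (C₁ C₂ : Matrix (Fin 3) (Fin 3) ℝ) (l₁ l₂ l₃ : ℝ) : Prop where
  sig₁ : OrderedSignature C₁
  sig₂ : OrderedSignature C₂
  eig₁ : Module.End.HasEigenvalue (Matrix.toLin' (C₁⁻¹ * C₂)) l₁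
  eig₂ : Module.End.HasEigenvalue (Matrix.toLin' (C₁⁻¹ * C₂)) l₂
  eig₃ : Module.End.HasEigenvalue (Matrix.toLin' (C₁⁻¹ * C₂)) l₃
  lt₁₂ : l₂ < l₁
  lt₂₃ : l₃ < l₂
  pos₃ : 0 < l₃
  nested : ∀ u : Fin 3 → ℝ, u ≠ 0 → quad C₂ u = 0 → quad C₁ u < 0

/-- The matrix `ν₁ C₁ + ν₂ C₂` of the element of the pencil with parameter `ν`. -/
def pencil (C₁ C₂ : Matrix (Fin 3) (Fin 3) ℝ) (ν : ℝ × ℝ) : Matrix (Fin 3) (Fin 3) ℝ :=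
  ν.1 • C₁ + ν.2 • C₂

/-- Valid parameter vectors: `ν₂ > 0` and `ν₁ + l₃ ν₂ > 0`. -/
def ValidParam (l₃ : ℝ) (ν : ℝ × ℝ) : Prop := 0 < ν.2 ∧ 0 < ν.1 + l₃ * ν.2

/-- `z₁` is the Poncelet image of `z₀`: the segment from `z₀` to `z₁` is nondegenerate and
tangent to the closed convex curve `Ci` (it meets `Ci`, and `Ci` lies on one side of it), with `Ci`
on the left when moving from `z₀` to `z₁`. -/
def PonceletStep (Ci : Set Plane) (z₀ z₁ : Plane) : Prop :=
  z₀ ≠ z₁ ∧ (∃ w ∈ Ci, w ∈ segment ℝ z₀ z₁) ∧ ∀ w ∈ Ci, 0 ≤ cross (z₁ - z₀) (w - z₀)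

open Classical in
/-- The Poncelet map of the outer curve `Co` with respect to the inner curve `Ci`: it sends `z` to
the unique point of `Co` that is the Poncelet image of `z` (and it fixes `z` if there is no such
unique point, which does not happen for nested ellipses). -/
def ponceletMap (Co Ci : Set Plane) (z : Co) : Co :=
  if h : ∃! w : Co, PonceletStep Ci z w then h.choose else z

/-- A counterclockwise parametrization of a strictly convex closed curve `S` by `ℝ / ℤ`: continuous,
`1`-periodic, onto, and such that any three points in order within one period form a positively
oriented triangle (in particular it is injective on `ℝ / ℤ`). -/
structure IsPositiveParam (S : Set Plane) (p : ℝ → S) : Prop where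
  continuous : Continuous p
  periodic : ∀ t, p (t + 1) = p t
  surjective : Function.Surjective p
  oriented : ∀ s t u : ℝ, s < t → t < u → u < s + 1 →
    0 < cross ((p t : Plane) - p s) ((p u : Plane) - p s)

/-- `r` is the rotation number, normalized to `[0, 1)`, of the map `P` of the curve `S`: under some
counterclockwise parametrization by `ℝ / ℤ`, the map `P` has a lift `f : ℝ → ℝ`
(monotone, with `f (t + 1) = f t + 1`) with `lim (fⁿ t - t) / n = r`. -/
def IsRotationNumber (S : Set Plane) (P : S → S) (r : ℝ) : Prop :=
  0 ≤ r ∧ r < 1 ∧ ∃ (p : ℝ → S) (f : CircleDeg1Lift), IsPositiveParam S p ∧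
    (∀ t, P (p t) = p (f t)) ∧ f.translationNumber = r

open Classical in
/-- The rotation number in `[0, 1)` of the map `P` of `S` (by convention `0` if it is not
well defined). -/
def rotationNumber (S : Set Plane) (P : S → S) : ℝ :=
  if h : ∃! r : ℝ, IsRotationNumber S P r then h.choose else 0

/-- The rotation number `ρ(ν)` of the Poncelet map of the outer ellipse `C₁` with respect to the
element of the pencil with parameter `ν`. -/
def rho (C₁ C₂ : Matrix (Fin 3) (Fin 3) ℝ) (ν : ℝ × ℝ) : ℝ :=
  rotationNumber (conic C₁) (ponceletMap (conic C₁) (conic (pencil C₁ C₂ ν)))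

/-- The incomplete elliptic integral of the first kind, with modulus `e`. -/
def ellipticF (φ e : ℝ) : ℝ := ∫ τ in (0 : ℝ)..φ, 1 / √(1 - e ^ 2 * Real.sin τ ^ 2)

/-- The complete elliptic integral of the first kind, with modulus `e`. -/
def ellipticK (e : ℝ) : ℝ := ellipticF (Real.pi / 2) e

/-- The pencil eccentricity. -/
def pencilEcc (l₁ l₂ l₃ : ℝ) : ℝ := √((l₁ - l₂) / (l₁ - l₃))

/-- The amplitude `ω(ν)`. -/
def omega (l₁ l₃ : ℝ) (ν : ℝ × ℝ) : ℝ :=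
  Real.arcsin (√((l₁ - l₃) * ν.2 / (l₁ * ν.2 + ν.1)))

end Poncelet

end

namespace Poncelet

/-! The eigenvectors of `C₁⁻¹ * C₂` diagonalize both forms at once. In the resulting projective
chart the outer conic is the unit circle and the conic of `ν` is x²/p + y²/r = 1, with p = (ν₁ +
l₃ν₂)/(ν₁ + l₁ν₂), r = (ν₁ + l₃ν₂)/(ν₁ + l₂ν₂) and p < r < 1. The denominator of the chart is
positive on the closed disc and the frame has positive determinant, so segments and orientation
survive and the Poncelet map can be computed in the disc (`DiagonalFrame`, `chartDen_pos`,
`cross_chart`).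

A chord of the circle with normal angle s joins the angles s - δ and s + δ, and it is tangent
exactly when cos δ is the support function of the ellipse at s. Jacobi's theorem
(`ellipticF_add_halfChord_sub`) says that F(s + δ, e) - F(s - δ, e) does not depend on s if e² r(1 -
p) = r - p. For the pencil this gives e² = (l₁ - l₂)/(l₁ - l₃), the same for every ν. So in the
coordinate F/(4K) each Poncelet map is the rotation by 2F(ω)/(4K), where cos² ω = p
(`ponceletMap_circ`), and this is its rotation number (`rotationNumber_eq_of_translate`).

ω increases with the sign of ν × μ. On the conic of μ the form of ν equals (ν × μ)/μ₂ times that of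
C₁, which is negative there. Thus both nesting and the order of the rotation numbers are decided by
ν × μ. -/

/-! ### Elliptic integrals and the amplitude -/

lemma elliptic_radicand_pos {e : ℝ} (he : e ^ 2 < 1) (τ : ℝ) :
    0 < 1 - e ^ 2 * Real.sin τ ^ 2 := by
  nlinarith [Real.sin_sq_le_one τ, sq_nonneg e, sq_nonneg (Real.sin τ)]

lemma continuous_elliptic_integrand {e : ℝ} (he : e ^ 2 < 1) :
    Continuous fun τ : ℝ => 1 / √(1 - e ^ 2 * Real.sin τ ^ 2) := by
  refine Continuous.div (by fun_prop) (by fun_prop) fun τ => ?_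
  exact (Real.sqrt_pos.2 (elliptic_radicand_pos he τ)).ne'

lemma one_le_elliptic_integrand {e : ℝ} (he : e ^ 2 < 1) (τ : ℝ) :
    1 ≤ 1 / √(1 - e ^ 2 * Real.sin τ ^ 2) := by
  have h := Real.sqrt_pos.2 (elliptic_radicand_pos he τ)
  rw [le_div_iff₀ h, one_mul]
  refine Real.sqrt_le_iff.2 ⟨zero_le_one, ?_⟩
  nlinarith [mul_nonneg (sq_nonneg e) (sq_nonneg (Real.sin τ))]

lemma hasDerivAt_ellipticF {e : ℝ} (he : e ^ 2 < 1) (φ : ℝ) :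
    HasDerivAt (fun φ => ellipticF φ e) (1 / √(1 - e ^ 2 * Real.sin φ ^ 2)) φ :=
  intervalIntegral.integral_hasDerivAt_right
    ((continuous_elliptic_integrand he).intervalIntegrable _ _)
    ((continuous_elliptic_integrand he).stronglyMeasurableAtFilter _ _)
    (continuous_elliptic_integrand he).continuousAt

lemma ellipticF_zero (e : ℝ) : ellipticF 0 e = 0 := intervalIntegral.integral_same

lemma continuous_ellipticF {e : ℝ} (he : e ^ 2 < 1) : Continuous fun φ => ellipticF φ e :=
  continuous_iff_continuousAt.2 fun φ => (hasDerivAt_ellipticF he φ).continuousAt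

/-- The integrand is at least 1; this growth bound yields both strict monotonicity and surjectivity
of F. -/
lemma sub_le_ellipticF_sub {e : ℝ} (he : e ^ 2 < 1) {a b : ℝ} (hab : a ≤ b) :
    b - a ≤ ellipticF b e - ellipticF a e := by
  have hi := fun x y => (continuous_elliptic_integrand he).intervalIntegrable (μ := MeasureTheory.volume) x y
  unfold ellipticF
  rw [intervalIntegral.integral_interval_sub_left (hi _ _) (hi _ _)]
  calc b - a = ∫ _ in a..b, (1 : ℝ) := by simp
    _ ≤ _ := intervalIntegral.integral_mono_on hab (by simp) (hi _ _)
      fun τ _ => one_le_elliptic_integrand he τ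

lemma strictMono_ellipticF {e : ℝ} (he : e ^ 2 < 1) : StrictMono fun φ => ellipticF φ e := by
  intro a b hab
  have := sub_le_ellipticF_sub he hab.le
  change ellipticF a e < ellipticF b e
  linarith

lemma surjective_ellipticF {e : ℝ} (he : e ^ 2 < 1) :
    Function.Surjective fun φ => ellipticF φ e := by
  refine (continuous_ellipticF he).surjective ?_ ?_
  · refine Filter.tendsto_atTop_mono' _ ?_ Filter.tendsto_id
    filter_upwards [Filter.eventually_ge_atTop 0] with x hx
    have := sub_le_ellipticF_sub he hx
    rw [ellipticF_zero] at this
    simp only [id]; linarith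
  · refine Filter.tendsto_atBot_mono' _ ?_ Filter.tendsto_id
    filter_upwards [Filter.eventually_le_atBot 0] with x hx
    have := sub_le_ellipticF_sub he hx
    rw [ellipticF_zero] at this
    simp only [id]; linarith

lemma ellipticF_neg (φ e : ℝ) : ellipticF (-φ) e = -ellipticF φ e := by
  unfold ellipticF
  rw [intervalIntegral.integral_symm, neg_inj]
  have := intervalIntegral.integral_comp_neg (a := 0) (b := φ)
    (fun τ : ℝ => 1 / √(1 - e ^ 2 * Real.sin τ ^ 2))
  simp only [Real.sin_neg, neg_sq, neg_zero] at this
  exact this.symm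

lemma ellipticF_pi {e : ℝ} (he : e ^ 2 < 1) : ellipticF Real.pi e = 2 * ellipticK e := by
  have hi := fun x y => (continuous_elliptic_integrand he).intervalIntegrable
    (μ := MeasureTheory.volume) x y
  have h1 := intervalIntegral.integral_comp_sub_left (a := 0) (b := Real.pi / 2)
    (fun τ : ℝ => 1 / √(1 - e ^ 2 * Real.sin τ ^ 2)) Real.pi
  simp only [Real.sin_pi_sub, sub_zero] at h1
  have h2 := intervalIntegral.integral_add_adjacent_intervals (hi 0 (Real.pi / 2))
    (hi (Real.pi / 2) Real.pi)
  rw [show Real.pi - Real.pi / 2 = Real.pi / 2 by ring] at h1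
  unfold ellipticK ellipticF
  linarith

lemma ellipticF_add_two_pi {e : ℝ} (he : e ^ 2 < 1) (φ : ℝ) :
    ellipticF (φ + 2 * Real.pi) e = ellipticF φ e + 4 * ellipticK e := by
  have hi := fun x y => (continuous_elliptic_integrand he).intervalIntegrable
    (μ := MeasureTheory.volume) x y
  have hper : Function.Periodic (fun τ : ℝ => 1 / √(1 - e ^ 2 * Real.sin τ ^ 2))
      (2 * Real.pi) := fun τ => by simp only [Real.sin_add_two_pi]
  have h1 := hper.intervalIntegral_add_eq φ (-Real.pi)
  rw [show -Real.pi + 2 * Real.pi = Real.pi by ring] at h1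
  have h2 := intervalIntegral.integral_interval_sub_left (hi 0 (φ + 2 * Real.pi)) (hi 0 φ)
  have h3 := intervalIntegral.integral_interval_sub_left (hi 0 Real.pi) (hi 0 (-Real.pi))
  have h4 : ellipticF Real.pi e - ellipticF (-Real.pi) e = 4 * ellipticK e := by
    rw [ellipticF_neg, ellipticF_pi he]; ring
  unfold ellipticF at h4 ⊢
  linarith

lemma ellipticF_pos {e φ : ℝ} (he : e ^ 2 < 1) (hφ : 0 < φ) : 0 < ellipticF φ e := by
  simpa [ellipticF_zero] using strictMono_ellipticF he hφ

lemma ellipticK_pos {e : ℝ} (he : e ^ 2 < 1) : 0 < ellipticK e :=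
  ellipticF_pos he (by positivity)

/-- The Jacobi amplitude: the inverse of `φ ↦ F(φ, e)`. -/
noncomputable def jacobiAm {e : ℝ} (he : e ^ 2 < 1) : ℝ ≃o ℝ :=
  ((strictMono_ellipticF he).orderIsoOfSurjective _ (surjective_ellipticF he)).symm

lemma ellipticF_jacobiAm {e : ℝ} (he : e ^ 2 < 1) (x : ℝ) : ellipticF (jacobiAm he x) e = x :=
  ((strictMono_ellipticF he).orderIsoOfSurjective _ (surjective_ellipticF he)).apply_symm_apply x

lemma jacobiAm_ellipticF {e : ℝ} (he : e ^ 2 < 1) (φ : ℝ) : jacobiAm he (ellipticF φ e) = φ :=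
  ((strictMono_ellipticF he).orderIsoOfSurjective _ (surjective_ellipticF he)).symm_apply_apply φ

lemma jacobiAm_add_four_ellipticK {e : ℝ} (he : e ^ 2 < 1) (x : ℝ) :
    jacobiAm he (x + 4 * ellipticK e) = jacobiAm he x + 2 * Real.pi := by
  rw [← jacobiAm_ellipticF he (jacobiAm he x + 2 * Real.pi), ellipticF_add_two_pi he,
    ellipticF_jacobiAm]

/-! ### Positive parametrizations and rotation numbers -/

lemma IsPositiveParam.apply_add_int {S : Set Plane} {p : ℝ → S} (hp : IsPositiveParam S p)
    (t : ℝ) (n : ℤ) : p (t + n) = p t := by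
  simpa using (Function.Periodic.int_mul (show Function.Periodic p 1 from hp.periodic) n) t

lemma IsPositiveParam.ne {S : Set Plane} {p : ℝ → S} (hp : IsPositiveParam S p) {s t : ℝ}
    (hst : s < t) (hts : t < s + 1) : p s ≠ p t := by
  intro h
  -- Any third parameter between t and s + 1 works: a triangle with two equal vertices has zero
  -- area.
  have := hp.oriented s t ((t + (s + 1)) / 2) hst (by linarith) (by linarith)
  simp [h, cross] at this

lemma IsPositiveParam.exists_int {S : Set Plane} {p : ℝ → S} (hp : IsPositiveParam S p)
    {s t : ℝ} (h : p s = p t) : ∃ n : ℤ, s = t + n := by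
  refine ⟨⌊s - t⌋, ?_⟩
  have h1 := Int.floor_le (s - t)
  have h2 := Int.lt_floor_add_one (s - t)
  by_contra hne
  have hlt : t + ⌊s - t⌋ < s := lt_of_le_of_ne (by linarith) (Ne.symm hne)
  apply hp.ne hlt (by linarith)
  rw [hp.apply_add_int, h]

lemma IsPositiveParam.exists_mem_Ico {S : Set Plane} {p : ℝ → S} (hp : IsPositiveParam S p)
    (c : ℝ) (z : S) : ∃ t, c ≤ t ∧ t < c + 1 ∧ p t = z := by
  obtain ⟨s, rfl⟩ := hp.surjective z
  refine ⟨s + (-⌊s - c⌋ : ℤ), ?_, ?_, hp.apply_add_int _ _⟩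
  · have := Int.floor_le (s - c)
    push_cast; linarith
  · have := Int.lt_floor_add_one (s - c)
    push_cast; linarith

/-- Two counterclockwise parametrizations of the same curve differ by a strictly monotone map of
degree one. -/
lemma IsPositiveParam.exists_lift {S : Set Plane} {p q : ℝ → S} (hp : IsPositiveParam S p)
    (hq : IsPositiveParam S q) :
    ∃ g : CircleDeg1Lift, StrictMono g ∧ ∀ t, p (g t) = q t := by
  obtain ⟨c, hc⟩ := hp.surjective (q 0)
  choose γ hγ1 hγ2 hγ3 using hp.exists_mem_Ico c
  have hγ0 : γ (q 0) = c := by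
    obtain ⟨n, hn⟩ := hp.exists_int ((hγ3 (q 0)).trans hc.symm)
    have h1 := hγ1 (q 0)
    have h2 := hγ2 (q 0)
    rw [hn] at h1 h2
    have h3 : (0 : ℝ) ≤ n := by linarith
    have h4 : (n : ℝ) < 1 := by linarith
    have h5 : n = 0 := by
      have : 0 ≤ n := by exact_mod_cast h3
      have : n < 1 := by exact_mod_cast h4
      omega
    simpa [h5] using hn
  have hmono : ∀ s t : ℝ, 0 ≤ s → s < t → t < 1 → γ (q s) < γ (q t) := by
    intro s t hs hst ht
    have hne : γ (q s) ≠ γ (q t) := fun h => hq.ne hst (by linarith) (by rw [← hγ3 (q s), h, hγ3])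
    rcases hs.eq_or_lt with rfl | hs
    · rw [hγ0] at hne ⊢
      exact lt_of_le_of_ne (hγ1 _) hne
    have hct : c < γ (q t) := by
      refine lt_of_le_of_ne (hγ1 _) fun h => ?_
      rw [← hγ0] at h
      exact hq.ne (hs.trans hst) (by linarith) (by rw [← hγ3 (q 0), h, hγ3])
    by_contra hlt
    have hlt : γ (q t) < γ (q s) := lt_of_le_of_ne (not_lt.1 hlt) hne.symm
    -- If the order were reversed, the same three points would form a positive triangle in both
    -- orders.
    have h1 := hp.oriented c _ _ hct hlt (hγ2 _)
    have h2 := hq.oriented 0 s t hs hst (by linarith)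
    rw [hc, hγ3, hγ3] at h1
    simp only [cross] at h1 h2
    linarith
  let g : ℝ → ℝ := fun t => γ (q (Int.fract t)) + ⌊t⌋
  have hg : StrictMono g := by
    intro s t hst
    have hs0 := Int.fract_nonneg s
    have ht1 := Int.fract_lt_one t
    change γ (q (Int.fract s)) + (⌊s⌋ : ℝ) < γ (q (Int.fract t)) + (⌊t⌋ : ℝ)
    rcases (Int.floor_le_floor hst.le).eq_or_lt with h | h
    · rw [h]
      have h1 : Int.fract s < Int.fract t := by
        rw [Int.fract, Int.fract, h]; linarith
      linarith [hmono _ _ hs0 h1 ht1]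
    · have h1 : (⌊s⌋ : ℝ) + 1 ≤ ⌊t⌋ := by exact_mod_cast h
      linarith [hγ1 (q (Int.fract t)), hγ2 (q (Int.fract s))]
  refine ⟨⟨⟨g, hg.monotone⟩, fun t => ?_⟩, hg, fun t => ?_⟩
  · change γ (q (Int.fract (t + 1))) + (⌊t + 1⌋ : ℝ) = γ (q (Int.fract t)) + (⌊t⌋ : ℝ) + 1
    rw [Int.fract_add_one, Int.floor_add_one]
    push_cast; ring
  · change p (γ (q (Int.fract t)) + (⌊t⌋ : ℝ)) = q t
    rw [hp.apply_add_int, hγ3]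
    conv_rhs => rw [← Int.fract_add_floor t, hq.apply_add_int]

/-- A map that some counterclockwise parametrization conjugates to the rotation by `ρ ∈ [0, 1)` has
rotation number `ρ`. -/
lemma rotationNumber_eq_of_translate {S : Set Plane} {P : S → S} {p : ℝ → S} {ρ : ℝ}
    (hp : IsPositiveParam S p) (h0 : 0 ≤ ρ) (h1 : ρ < 1) (hP : ∀ t, P (p t) = p (t + ρ)) :
    rotationNumber S P = ρ := by
  have hρ : IsRotationNumber S P ρ := by
    refine ⟨h0, h1, p, CircleDeg1Lift.translate (Multiplicative.ofAdd ρ), hp, fun t => ?_,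
      CircleDeg1Lift.translationNumber_translate ρ⟩
    rw [CircleDeg1Lift.translate_apply, hP, add_comm]
  have huniq : ∀ r, IsRotationNumber S P r → r = ρ := by
    rintro r ⟨hr0, hr1, q, f, hq, hf, rfl⟩
    obtain ⟨g, hg, hpg⟩ := hp.exists_lift hq
    -- The change of parameter g conjugates f to the translation by ρ up to an integer n t. This
    -- integer is periodic and monotone over each period, hence constant.
    have hn : ∀ t, ∃ n : ℤ, g (f t) = g t + ρ + n := fun t => by
      apply hp.exists_int
      rw [hpg, ← hf, ← hpg, hP]
    choose n hn using hn
    have hper : ∀ t, n (t + 1) = n t := fun t => by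
      have := hn (t + 1)
      rw [f.map_add_one, g.map_add_one, g.map_add_one, hn t] at this
      have : (n t : ℝ) = n (t + 1) := by linarith
      exact_mod_cast this.symm
    have hle : ∀ s t, s < t → t < s + 1 → n s ≤ n t := fun s t hst hts => by
      have h2 := g.monotone (f.monotone hst.le)
      have h3 := hg hts
      rw [g.map_add_one] at h3
      rw [hn, hn] at h2
      have : (n s : ℝ) < n t + 1 := by linarith
      exact Int.lt_add_one_iff.1 (by exact_mod_cast this)
    have hconst : ∀ t, n t = n 0 := by
      have hfr : ∀ t, 0 ≤ t → t < 1 → n t = n 0 := fun t ht0 ht1 => by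
        rcases ht0.eq_or_lt with rfl | ht0
        · rfl
        apply le_antisymm _ (hle 0 t ht0 (by linarith))
        have := hle t (0 + 1) (by linarith) (by linarith)
        rwa [hper] at this
      intro t
      have := (Function.Periodic.int_mul (show Function.Periodic n 1 from hper) ⌊t⌋) (Int.fract t)
      rw [mul_one, Int.fract_add_floor] at this
      rw [this]
      exact hfr _ (Int.fract_nonneg t) (Int.fract_lt_one t)
    have hτ : f.translationNumber = ρ + n 0 := by
      rw [← CircleDeg1Lift.translationNumber_translate (ρ + n 0)]
      refine CircleDeg1Lift.translationNumber_eq_of_semiconj (f := g) fun t => ?_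
      rw [CircleDeg1Lift.translate_apply, hn, hconst]
      ring
    rw [hτ] at hr0 hr1 ⊢
    -- Both ρ and ρ + n 0 lie in [0, 1).
    have h3 : (-1 : ℝ) < n 0 := by linarith
    have h4 : (n 0 : ℝ) < 1 := by linarith
    have h5 : n 0 = 0 := by
      have : -1 < n 0 := by exact_mod_cast h3
      have : n 0 < 1 := by exact_mod_cast h4
      omega
    simp [h5]
  have hex : ∃! r, IsRotationNumber S P r := ⟨ρ, hρ, huniq⟩
  rw [rotationNumber, dif_pos hex]
  exact huniq _ hex.choose_spec.1

/-! ### Tangent chords in the disc and Jacobi's theorem -/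

/-- Squared support function of the ellipse `x² / p + y² / r = 1` in the direction of angle `s`. -/
noncomputable def supportSq (p r s : ℝ) : ℝ := p * Real.cos s ^ 2 + r * Real.sin s ^ 2

/-- Half the angle subtended by the chord of the unit circle that is tangent to the ellipse
`x² / p + y² / r = 1` and has outer normal of angle `s`. -/
noncomputable def halfChord (p r s : ℝ) : ℝ := Real.arccos √(supportSq p r s)

/-- The ellipse `x² / p + y² / r = 1` is not a circle and lies inside the unit circle; its major
axis is vertical. -/
structure NestedAxes (p r : ℝ) : Prop where
  pos : 0 < p
  lt : p < r
  lt_one : r < 1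

namespace NestedAxes
variable {p r : ℝ}

lemma supportSq_pos (h : NestedAxes p r) (s : ℝ) : 0 < supportSq p r s := by
  have := Real.sin_sq_add_cos_sq s
  have := h.pos; have := h.lt
  unfold supportSq
  nlinarith [sq_nonneg (Real.sin s), sq_nonneg (Real.cos s)]

lemma supportSq_lt_one (h : NestedAxes p r) (s : ℝ) : supportSq p r s < 1 := by
  have := Real.sin_sq_add_cos_sq s
  have := h.pos; have := h.lt; have := h.lt_one
  unfold supportSq
  nlinarith [sq_nonneg (Real.sin s), sq_nonneg (Real.cos s)]

lemma cos_halfChord (h : NestedAxes p r) (s : ℝ) :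
    Real.cos (halfChord p r s) = √(supportSq p r s) :=
  Real.cos_arccos (by linarith [Real.sqrt_nonneg (supportSq p r s)])
    (Real.sqrt_le_iff.2 ⟨zero_le_one, by linarith [h.supportSq_lt_one s]⟩)

lemma sin_halfChord (h : NestedAxes p r) (s : ℝ) :
    Real.sin (halfChord p r s) = √(1 - supportSq p r s) := by
  rw [halfChord, Real.sin_arccos, Real.sq_sqrt (h.supportSq_pos s).le]

lemma halfChord_pos (h : NestedAxes p r) (s : ℝ) : 0 < halfChord p r s := by
  rw [halfChord, Real.arccos_pos, Real.sqrt_lt' one_pos]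
  simpa using h.supportSq_lt_one s

lemma halfChord_lt (h : NestedAxes p r) (s : ℝ) : halfChord p r s < Real.pi / 2 := by
  rw [halfChord, Real.arccos_lt_pi_div_two]
  exact Real.sqrt_pos.2 (h.supportSq_pos s)

/-- The contact point of a tangent chord lies strictly between its endpoints. -/
lemma abs_contact_lt (h : NestedAxes p r) (s : ℝ) :
    |(r - p) * Real.sin s * Real.cos s| < √(supportSq p r s) * √(1 - supportSq p r s) := by
  have hpos := h.supportSq_pos s
  rw [← Real.sqrt_mul hpos.le]
  apply Real.lt_sqrt_of_sq_lt
  rw [sq_abs]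
  have hsc := Real.sin_sq_add_cos_sq s
  -- The gap between the squares is a combination of cos² and sin² with positive coefficients.
  have key : supportSq p r s * (1 - supportSq p r s) - ((r - p) * Real.sin s * Real.cos s) ^ 2
      = p * (1 - p) * Real.cos s ^ 2 + r * (1 - r) * Real.sin s ^ 2 := by
    have hc : Real.cos s ^ 2 = 1 - Real.sin s ^ 2 := by linarith
    simp only [supportSq, mul_pow, hc]
    ring
  have h1 : 0 < p * (1 - p) := mul_pos h.pos (by linarith [h.lt, h.lt_one])
  have h2 : 0 < r * (1 - r) := mul_pos (by linarith [h.pos, h.lt]) (by linarith [h.lt_one])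
  have : 0 < p * (1 - p) * Real.cos s ^ 2 + r * (1 - r) * Real.sin s ^ 2 := by
    rcases eq_or_ne (Real.sin s) 0 with h0 | h0
    · have : Real.cos s ^ 2 = 1 := by rw [h0] at hsc; linarith
      rw [this, h0]; linarith
    · have := mul_pos h2 (by positivity : 0 < Real.sin s ^ 2)
      nlinarith [sq_nonneg (Real.cos s)]
  linarith

lemma hasDerivAt_halfChord (h : NestedAxes p r) (s : ℝ) :
    HasDerivAt (halfChord p r) (-((r - p) * Real.sin s * Real.cos s /
      (√(supportSq p r s) * √(1 - supportSq p r s)))) s := by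
  have hpos := h.supportSq_pos s
  have hlt := h.supportSq_lt_one s
  have h1 : HasDerivAt (supportSq p r) (2 * ((r - p) * Real.sin s * Real.cos s)) s := by
    have := (((Real.hasDerivAt_cos s).pow 2).const_mul p).add
      (((Real.hasDerivAt_sin s).pow 2).const_mul r)
    refine this.congr_deriv ?_
    norm_num
    ring
  have h2 := h1.sqrt hpos.ne'
  have h3 := (Real.hasDerivAt_arccos (x := √(supportSq p r s))
    (by linarith [Real.sqrt_nonneg (supportSq p r s)])
    (by rw [Ne, Real.sqrt_eq_one]; exact hlt.ne)).comp s h2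
  refine h3.congr_deriv ?_
  rw [Real.sq_sqrt hpos.le]
  have := (Real.sqrt_pos.2 hpos).ne'
  have := (Real.sqrt_pos.2 (sub_pos.2 hlt)).ne'
  field_simp

/-- With H² the squared support, S² = 1 - H² and k = (r - p) sin s cos s, the condition on e turns
r(1 - p)(1 - e² sin²) at s ± δ into the perfect square (HS ∓ k)². `abs_contact_lt` fixes the sign of
the root. Geometrically, (HS ∓ k)/H is the distance from the endpoint to the contact point. -/
lemma integrand_add_halfChord (h : NestedAxes p r) {e : ℝ} (he : e ^ 2 * (r * (1 - p)) = r - p)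
    (s : ℝ) :
    1 / √(1 - e ^ 2 * Real.sin (s + halfChord p r s) ^ 2) = √(r * (1 - p)) /
      (√(supportSq p r s) * √(1 - supportSq p r s) - (r - p) * Real.sin s * Real.cos s) ∧
    1 / √(1 - e ^ 2 * Real.sin (s - halfChord p r s) ^ 2) = √(r * (1 - p)) /
      (√(supportSq p r s) * √(1 - supportSq p r s) + (r - p) * Real.sin s * Real.cos s) := by
  have hQ : 0 < r * (1 - p) :=
    mul_pos (by linarith [h.pos, h.lt]) (by linarith [h.lt, h.lt_one])
  have hab := abs_lt.1 (h.abs_contact_lt s)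
  have hpos := h.supportSq_pos s
  have hlt := h.supportSq_lt_one s
  have hsc := Real.sin_sq_add_cos_sq s
  rw [Real.sin_add, Real.sin_sub, h.cos_halfChord, h.sin_halfChord]
  have hH := Real.sq_sqrt hpos.le
  have hS := Real.sq_sqrt (sub_pos.2 hlt).le
  set H := √(supportSq p r s)
  set S := √(1 - supportSq p r s)
  set a := Real.sin s
  set b := Real.cos s
  have hb : b ^ 2 = 1 - a ^ 2 := by linarith
  have hsup : supportSq p r s = p * b ^ 2 + r * a ^ 2 := rfl
  rw [hsup, hb] at hH hS
  have aux : ∀ X Y : ℝ, 0 < Y → r * (1 - p) * (1 - e ^ 2 * X ^ 2) = Y ^ 2 →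
      1 / √(1 - e ^ 2 * X ^ 2) = √(r * (1 - p)) / Y := by
    intro X Y hY hXY
    have : 1 - e ^ 2 * X ^ 2 = Y ^ 2 / (r * (1 - p)) := by
      rw [eq_div_iff hQ.ne', ← hXY]; ring
    rw [this, Real.sqrt_div (sq_nonneg Y), Real.sqrt_sq hY.le, one_div_div]
  constructor
  · apply aux _ _ (by linarith [hab.2])
    have : r * (1 - p) * (1 - e ^ 2 * (a * H + b * S) ^ 2)
      = r * (1 - p) - (r - p) * (a * H + b * S) ^ 2 := by rw [← he]; ring
    rw [this]
    have e1 : (a * H + b * S) ^ 2 = a ^ 2 * H ^ 2 + b ^ 2 * S ^ 2 + 2 * (a * b * H * S) := by ring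
    have e2 : (H * S - (r - p) * a * b) ^ 2 =
      H ^ 2 * S ^ 2 + (r - p) ^ 2 * a ^ 2 * b ^ 2 - 2 * (r - p) * (a * b * H * S) := by ring
    rw [e1, e2, hH, hS, hb]; ring
  · apply aux _ _ (by linarith [hab.1])
    have : r * (1 - p) * (1 - e ^ 2 * (a * H - b * S) ^ 2)
      = r * (1 - p) - (r - p) * (a * H - b * S) ^ 2 := by rw [← he]; ring
    rw [this]
    have e1 : (a * H - b * S) ^ 2 = a ^ 2 * H ^ 2 + b ^ 2 * S ^ 2 - 2 * (a * b * H * S) := by ring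
    have e2 : (H * S + (r - p) * a * b) ^ 2 =
      H ^ 2 * S ^ 2 + (r - p) ^ 2 * a ^ 2 * b ^ 2 + 2 * (r - p) * (a * b * H * S) := by ring
    rw [e1, e2, hH, hS, hb]; ring

/-- Jacobi's theorem: all chords of the unit circle that are tangent to the ellipse
`x² / p + y² / r = 1` subtend arcs of equal elliptic length. -/
lemma ellipticF_add_halfChord_sub (h : NestedAxes p r) {e : ℝ} (he1 : e ^ 2 < 1)
    (he : e ^ 2 * (r * (1 - p)) = r - p) (s : ℝ) :
    ellipticF (s + halfChord p r s) e - ellipticF (s - halfChord p r s) e =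
      2 * ellipticF (Real.arccos √p) e := by
  have hd : ∀ s, HasDerivAt (fun s => ellipticF (s + halfChord p r s) e -
      ellipticF (s - halfChord p r s) e) 0 s := by
    intro s
    have hδ := h.hasDerivAt_halfChord s
    have h1 := (hasDerivAt_ellipticF he1 (s + halfChord p r s)).comp s ((hasDerivAt_id s).add hδ)
    have h2 := (hasDerivAt_ellipticF he1 (s - halfChord p r s)).comp s ((hasDerivAt_id s).sub hδ)
    refine (h1.sub h2).congr_deriv ?_
    rw [(h.integrand_add_halfChord he s).1, (h.integrand_add_halfChord he s).2]
    have hab := abs_lt.1 (h.abs_contact_lt s)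
    have hH := (Real.sqrt_pos.2 (h.supportSq_pos s)).ne'
    have hS := (Real.sqrt_pos.2 (sub_pos.2 (h.supportSq_lt_one s))).ne'
    set H := √(supportSq p r s)
    set S := √(1 - supportSq p r s)
    have n1 : H * S - (r - p) * Real.sin s * Real.cos s ≠ 0 := by linarith [hab.2]
    have n2 : H * S + (r - p) * Real.sin s * Real.cos s ≠ 0 := by linarith [hab.1]
    set k := (r - p) * Real.sin s * Real.cos s
    -- The endpoint speeds 1 ± δ' cancel the denominators of the integrands, so both ends contribute
    -- √(r(1 - p))/(HS).
    have e1 : 1 + -(k / (H * S)) = (H * S - k) / (H * S) := by field_simp; ring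
    have e2 : 1 - -(k / (H * S)) = (H * S + k) / (H * S) := by field_simp; ring
    rw [e1, e2]
    field_simp
    ring
  -- The constant is read off at s = 0, where the chord is symmetric and δ = arccos √p.
  have hc := is_const_of_deriv_eq_zero (fun s => (hd s).differentiableAt) (fun s => (hd s).deriv)
    s 0
  rw [hc, zero_add, zero_sub, ellipticF_neg]
  simp only [halfChord, supportSq, Real.cos_zero, Real.sin_zero]
  norm_num
  ring

/-- δ is continuous and bounded, so every point of the circle starts a tangent chord. -/
lemma exists_sub_halfChord (h : NestedAxes p r) (φ : ℝ) : ∃ s, s - halfChord p r s = φ := by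
  have hc : Continuous fun s => s - halfChord p r s := by
    unfold halfChord supportSq
    fun_prop
  refine hc.surjective ?_ ?_ φ
  · refine Filter.tendsto_atTop_mono (fun s => ?_)
      (Filter.tendsto_atTop_add_const_right _ (-Real.pi) Filter.tendsto_id)
    simp only [id]
    linarith [h.halfChord_lt s, Real.pi_pos]
  · refine Filter.tendsto_atBot_mono (fun s => ?_) Filter.tendsto_id
    simp only [id]
    linarith [h.halfChord_pos s]

end NestedAxes

/-! ### Simultaneous diagonalization -/

/-- A linear frame that diagonalizes the pencil of `C₁` and `C₂` simultaneously, preserves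
orientation, and respects the line at infinity. -/
structure DiagonalFrame (C₁ C₂ : Matrix (Fin 3) (Fin 3) ℝ) (l₁ l₂ l₃ : ℝ)
    (M : Matrix (Fin 3) (Fin 3) ℝ) : Prop where
  det_pos : 0 < M.det
  apex_pos : 0 < M 2 2
  quad₁ : ∀ X, quad C₁ (M *ᵥ X) = X 0 ^ 2 + X 1 ^ 2 - X 2 ^ 2
  quad₂ : ∀ X, quad C₂ (M *ᵥ X) = l₁ * X 0 ^ 2 + l₂ * X 1 ^ 2 - l₃ * X 2 ^ 2
  pos : ∀ u : Fin 3 → ℝ, u 2 = 0 → u ≠ 0 → 0 < quad C₁ u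

lemma OrderedSignature.quad_pos {C : Matrix (Fin 3) (Fin 3) ℝ} (h : OrderedSignature C)
    {u : Fin 3 → ℝ} (hu2 : u 2 = 0) (hu : u ≠ 0) : 0 < quad C u := by
  have h1 : u = ![u 0, u 1, 0] := by
    ext i; fin_cases i <;> simp [hu2]
  rw [h1]
  apply h.pos
  rintro h2
  apply hu
  rw [Prod.mk.injEq] at h2
  rw [h1, h2.1, h2.2]
  ext i; fin_cases i <;> rfl

lemma dotProduct_mulVec_comm {C : Matrix (Fin 3) (Fin 3) ℝ} (hC : C.IsSymm) (u v : Fin 3 → ℝ) :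
    u ⬝ᵥ (C *ᵥ v) = v ⬝ᵥ (C *ᵥ u) := by
  rw [Matrix.dotProduct_mulVec, ← Matrix.mulVec_transpose, hC.eq, dotProduct_comm]

lemma quad_combination {C : Matrix (Fin 3) (Fin 3) ℝ} {v : Fin 3 → Fin 3 → ℝ}
    (hv : ∀ i j, i ≠ j → v i ⬝ᵥ (C *ᵥ v j) = 0) (x y z : ℝ) :
    quad C (x • v 0 + y • v 1 + z • v 2) =
      x ^ 2 * quad C (v 0) + y ^ 2 * quad C (v 1) + z ^ 2 * quad C (v 2) := by
  have h01 := hv 0 1 (by decide)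
  have h02 := hv 0 2 (by decide)
  have h10 := hv 1 0 (by decide)
  have h12 := hv 1 2 (by decide)
  have h20 := hv 2 0 (by decide)
  have h21 := hv 2 1 (by decide)
  simp only [quad, Matrix.mulVec_add, Matrix.mulVec_smul, dotProduct_add, add_dotProduct,
    dotProduct_smul, smul_dotProduct, smul_eq_mul, h01, h02, h10, h12, h20, h21]
  ring

/-- Normalizing an eigenvector leaves its sign free; the sign is used to orient the frame. -/
lemma exists_sq_mul_eq_one {d x : ℝ} (hd : 0 < d) (hx : x ≠ 0) :
    ∃ c : ℝ, c ^ 2 * d = 1 ∧ 0 < c * x := by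
  have hs := Real.sqrt_pos.2 hd
  have h2 := Real.sq_sqrt hd.le
  rcases hx.lt_or_gt with hx | hx
  · refine ⟨-(1 / √d), ?_, ?_⟩
    · rw [neg_sq, div_pow, h2]; field_simp
    · have : 0 < 1 / √d := by positivity
      nlinarith
  · refine ⟨1 / √d, ?_, by positivity⟩
    rw [div_pow, h2]; field_simp

/-- The eigenvectors of `C₁⁻¹ C₂` form a basis that is orthogonal for both forms; the smallest
eigenvalue belongs to the negative direction. -/
lemma StandingAssumptions.exists_eigenbasis {C₁ C₂ : Matrix (Fin 3) (Fin 3) ℝ} {l₁ l₂ l₃ : ℝ}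
    (hC : StandingAssumptions C₁ C₂ l₁ l₂ l₃) :
    ∃ v : Fin 3 → Fin 3 → ℝ, (Matrix.of v).det ≠ 0 ∧
      (∀ i j, i ≠ j → v i ⬝ᵥ (C₁ *ᵥ v j) = 0) ∧ (∀ i j, i ≠ j → v i ⬝ᵥ (C₂ *ᵥ v j) = 0) ∧
      (∀ i, quad C₂ (v i) = ![l₁, l₂, l₃] i * quad C₁ (v i)) ∧
      0 < quad C₁ (v 0) ∧ 0 < quad C₁ (v 1) ∧ quad C₁ (v 2) < 0 := by
  have h12 := hC.lt₁₂
  have h23 := hC.lt₂₃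
  have hl3 := hC.pos₃
  have heig : ∀ i, Module.End.HasEigenvalue (Matrix.toLin' (C₁⁻¹ * C₂)) (![l₁, l₂, l₃] i) := by
    intro i
    fin_cases i
    exacts [hC.eig₁, hC.eig₂, hC.eig₃]
  choose v hv using fun i => (heig i).exists_hasEigenvector
  have hinj : Function.Injective ![l₁, l₂, l₃] := by
    intro i j hij
    fin_cases i <;> fin_cases j <;> simp at hij ⊢ <;> linarith
  have hli := Module.End.eigenvectors_linearIndependent' _ _ hinj v hv
  have hdet : (Matrix.of v).det ≠ 0 := by
    rw [← isUnit_iff_ne_zero, ← Matrix.isUnit_iff_isUnit_det,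
      ← Matrix.linearIndependent_rows_iff_isUnit]
    exact hli
  have hmul : ∀ i, C₂ *ᵥ v i = ![l₁, l₂, l₃] i • (C₁ *ᵥ v i) := by
    intro i
    have h1 := (hv i).apply_eq_smul
    rw [Matrix.toLin'_apply] at h1
    rw [← Matrix.mulVec_smul, ← h1, Matrix.mulVec_mulVec, Matrix.mul_nonsing_inv_cancel_left]
    exact isUnit_iff_ne_zero.2 hC.sig₁.det_neg.ne
  have ho1 : ∀ i j, i ≠ j → v i ⬝ᵥ (C₁ *ᵥ v j) = 0 := by
    intro i j hij
    have h1 := dotProduct_mulVec_comm hC.sig₂.symm (v i) (v j)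
    rw [hmul, hmul, dotProduct_smul, dotProduct_smul,
      dotProduct_mulVec_comm hC.sig₁.symm (v j) (v i), smul_eq_mul, smul_eq_mul] at h1
    have h2 : ![l₁, l₂, l₃] j - ![l₁, l₂, l₃] i ≠ 0 := sub_ne_zero.2 fun h => hij (hinj h).symm
    exact (mul_eq_zero.1 (by linarith : (![l₁, l₂, l₃] j - ![l₁, l₂, l₃] i) *
      (v i ⬝ᵥ (C₁ *ᵥ v j)) = 0)).resolve_left h2
  have ho2 : ∀ i j, i ≠ j → v i ⬝ᵥ (C₂ *ᵥ v j) = 0 := by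
    intro i j hij
    rw [hmul, dotProduct_smul, ho1 i j hij, smul_zero]
  have hq : ∀ i, quad C₂ (v i) = ![l₁, l₂, l₃] i * quad C₁ (v i) := by
    intro i
    rw [quad, hmul, dotProduct_smul, smul_eq_mul, quad]
  refine ⟨v, hdet, ho1, ho2, hq, ?_⟩
  -- C₁ is congruent to the diagonal matrix of these values, and its determinant is negative.
  have hprod : quad C₁ (v 0) * quad C₁ (v 1) * quad C₁ (v 2) < 0 := by
    have hD : Matrix.of v * C₁ * (Matrix.of v)ᵀ = Matrix.diagonal fun i => quad C₁ (v i) := by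
      ext i j
      have h1 : (Matrix.of v * C₁ * (Matrix.of v)ᵀ) i j = v i ⬝ᵥ (C₁ *ᵥ v j) := by
        rw [Matrix.mul_assoc]; rfl
      rw [h1, Matrix.diagonal_apply]
      split_ifs with hij
      · rw [hij, quad]
      · exact ho1 i j hij
    have h2 := congrArg Matrix.det hD
    rw [Matrix.det_mul, Matrix.det_mul, Matrix.det_transpose, Matrix.det_diagonal,
      Fin.prod_univ_three] at h2
    rw [← h2]
    have := mul_pos_of_neg_of_neg hC.sig₁.det_neg (neg_neg_of_pos (by positivity :
      0 < (Matrix.of v).det ^ 2))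
    linarith
  have hne : ∀ x y z : ℝ, x • v 0 + y • v 1 + z • v 2 = 0 → x = 0 ∧ y = 0 ∧ z = 0 := by
    intro x y z h
    have := (Fintype.linearIndependent_iff.1 hli) ![x, y, z]
      (by simpa [Fin.sum_univ_three] using h)
    exact ⟨this 0, this 1, this 2⟩
  have hnest : ∀ x y z : ℝ, (x ≠ 0 ∨ y ≠ 0 ∨ z ≠ 0) →
      l₁ * (x ^ 2 * quad C₁ (v 0)) + l₂ * (y ^ 2 * quad C₁ (v 1)) +
        l₃ * (z ^ 2 * quad C₁ (v 2)) = 0 →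
      x ^ 2 * quad C₁ (v 0) + y ^ 2 * quad C₁ (v 1) + z ^ 2 * quad C₁ (v 2) < 0 := by
    intro x y z hxyz h0
    rw [← quad_combination ho1]
    apply hC.nested
    · intro h
      have := hne x y z h
      tauto
    · rw [quad_combination ho2, hq, hq, hq]
      simp only [Matrix.cons_val]
      linarith
  have hpos : ∃ x y z : ℝ,
      0 < x ^ 2 * quad C₁ (v 0) + y ^ 2 * quad C₁ (v 1) + z ^ 2 * quad C₁ (v 2) := by
    have hu : IsUnit (Matrix.of v)ᵀ.det := by
      rw [Matrix.det_transpose]; exact isUnit_iff_ne_zero.2 hdet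
    set X := (Matrix.of v)ᵀ⁻¹ *ᵥ ![1, 0, 0]
    have hX : (Matrix.of v)ᵀ *ᵥ X = ![1, 0, 0] := by
      rw [Matrix.mulVec_mulVec, Matrix.mul_nonsing_inv _ hu, Matrix.one_mulVec]
    refine ⟨X 0, X 1, X 2, ?_⟩
    rw [← quad_combination ho1]
    have : X 0 • v 0 + X 1 • v 1 + X 2 • v 2 = ![1, 0, 0] := by
      rw [← hX]
      ext i
      simp [Matrix.mulVec, dotProduct, Fin.sum_univ_three, mul_comm]
    rw [this]
    exact hC.sig₁.pos 1 0 (by simp)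
  set d0 := quad C₁ (v 0)
  set d1 := quad C₁ (v 1)
  set d2 := quad C₁ (v 2)
  have hd0 : d0 ≠ 0 := by rintro h; simp [h] at hprod
  have hd1 : d1 ≠ 0 := by rintro h; simp [h] at hprod
  have hd2 : d2 ≠ 0 := by rintro h; simp [h] at hprod
  -- Otherwise d0 or d1 is negative, say dᵢ. The span of v i and v 2 then has a vector isotropic for
  -- C₂ on which C₁ takes the value d2 (-dᵢ)(lᵢ - l₃) > 0, against nesting.
  have h2 : d2 < 0 := by
    by_contra h2
    have h2 : 0 < d2 := lt_of_le_of_ne (not_lt.1 h2) hd2.symm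
    have h01 : d0 * d1 < 0 := by
      by_contra h
      have := mul_nonneg (not_lt.1 h) h2.le
      linarith
    rcases mul_neg_iff.1 h01 with ⟨_, h1⟩ | ⟨h0, _⟩
    · have a1 : 0 < l₃ * d2 := by positivity
      have a2 : 0 < -(l₂ * d1) := by nlinarith
      have := hnest 0 √(l₃ * d2) √(-(l₂ * d1)) (Or.inr (Or.inl (Real.sqrt_pos.2 a1).ne'))
        (by rw [Real.sq_sqrt a1.le, Real.sq_sqrt a2.le]; ring)
      rw [Real.sq_sqrt a1.le, Real.sq_sqrt a2.le] at this
      have := mul_pos (mul_pos h2 (neg_pos.2 h1)) (sub_pos.2 h23)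
      linarith
    · have a1 : 0 < l₃ * d2 := by positivity
      have a2 : 0 < -(l₁ * d0) := by nlinarith
      have := hnest √(l₃ * d2) 0 √(-(l₁ * d0)) (Or.inl (Real.sqrt_pos.2 a1).ne')
        (by rw [Real.sq_sqrt a1.le, Real.sq_sqrt a2.le]; ring)
      rw [Real.sq_sqrt a1.le, Real.sq_sqrt a2.le] at this
      have := mul_pos (mul_pos h2 (neg_pos.2 h0)) (sub_pos.2 (h23.trans h12))
      linarith
  have h01 : 0 < d0 * d1 := by
    by_contra h
    have := mul_nonneg_of_nonpos_of_nonpos (not_lt.1 h) h2.le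
    linarith
  rcases pos_and_pos_or_neg_and_neg_of_mul_pos h01 with ⟨h0, h1⟩ | ⟨h0, h1⟩
  · exact ⟨h0, h1, h2⟩
  -- Three negative values are excluded because C₁ is positive somewhere.
  · obtain ⟨x, y, z, h⟩ := hpos
    have := mul_nonneg (sq_nonneg x) (neg_nonneg.2 h0.le)
    have := mul_nonneg (sq_nonneg y) (neg_nonneg.2 h1.le)
    have := mul_nonneg (sq_nonneg z) (neg_nonneg.2 h2.le)
    linarith

lemma StandingAssumptions.exists_diagonalFrame {C₁ C₂ : Matrix (Fin 3) (Fin 3) ℝ} {l₁ l₂ l₃ : ℝ}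
    (hC : StandingAssumptions C₁ C₂ l₁ l₂ l₃) : ∃ M, DiagonalFrame C₁ C₂ l₁ l₂ l₃ M := by
  obtain ⟨v, hdet, ho1, ho2, hq, h0, h1, h2⟩ := hC.exists_eigenbasis
  have hv2 : v 2 ≠ 0 := by
    intro h
    rw [h] at h2
    simp [quad] at h2
  have hv22 : v 2 2 ≠ 0 := fun h => by
    have := hC.sig₁.quad_pos h hv2
    linarith
  -- The sign of c2 makes the apex coordinate positive, that of c1 is immaterial, and that of c0
  -- makes the determinant positive.
  obtain ⟨c2, hc2, hp2⟩ := exists_sq_mul_eq_one (neg_pos.2 h2) hv22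
  obtain ⟨c1, hc1, hp1⟩ := exists_sq_mul_eq_one h1 one_ne_zero
  have hc2' : c2 ≠ 0 := by rintro rfl; simp at hp2
  have hc1' : c1 ≠ 0 := by rintro rfl; simp at hp1
  obtain ⟨c0, hc0, hp0⟩ := exists_sq_mul_eq_one h0 (mul_ne_zero (mul_ne_zero hdet hc1') hc2')
  have hM : ∀ X : Fin 3 → ℝ, ((Matrix.of v)ᵀ * Matrix.diagonal ![c0, c1, c2]) *ᵥ X =
      (c0 * X 0) • v 0 + (c1 * X 1) • v 1 + (c2 * X 2) • v 2 := by
    intro X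
    ext i
    simp [Matrix.mulVec, dotProduct, Fin.sum_univ_three, Matrix.mul_diagonal]
    ring
  refine ⟨(Matrix.of v)ᵀ * Matrix.diagonal ![c0, c1, c2], ?_, ?_, ?_, ?_, fun u => hC.sig₁.quad_pos⟩
  · rw [Matrix.det_mul, Matrix.det_transpose, Matrix.det_diagonal, Fin.prod_univ_three]
    simp only [Matrix.cons_val]
    linarith
  · simpa [Matrix.mul_diagonal, mul_comm] using hp2
  · intro X
    rw [hM, quad_combination ho1]
    linear_combination X 0 ^ 2 * hc0 + X 1 ^ 2 * hc1 - X 2 ^ 2 * hc2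
  · intro X
    rw [hM, quad_combination ho2, hq, hq, hq]
    simp only [Matrix.cons_val]
    linear_combination l₁ * X 0 ^ 2 * hc0 + l₂ * X 1 ^ 2 * hc1 - l₃ * X 2 ^ 2 * hc2

/-! ### The projective chart -/

/-- The affine point with homogeneous coordinates `u`. -/
noncomputable def dehomog (u : Fin 3 → ℝ) : Plane := (u 0 / u 2, u 1 / u 2)

/-- The affine chart defined by a projective frame. -/
noncomputable def chart (M : Matrix (Fin 3) (Fin 3) ℝ) (x y : ℝ) : Plane :=
  dehomog (M *ᵥ ![x, y, 1])

/-- The common denominator of the coordinates of `chart M x y`. -/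
noncomputable def chartDen (M : Matrix (Fin 3) (Fin 3) ℝ) (x y : ℝ) : ℝ := (M *ᵥ ![x, y, 1]) 2

lemma homog_dehomog {u : Fin 3 → ℝ} (hu : u 2 ≠ 0) : homog (dehomog u) = (u 2)⁻¹ • u := by
  ext i
  fin_cases i <;> simp [homog, dehomog, hu, div_eq_inv_mul]

lemma dehomog_homog (z : Plane) : dehomog (homog z) = z := by
  simp [homog, dehomog]

lemma dehomog_smul {a : ℝ} (ha : a ≠ 0) (u : Fin 3 → ℝ) : dehomog (a • u) = dehomog u := by
  simp [dehomog, mul_div_mul_left _ _ ha]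

lemma quad_smul (C : Matrix (Fin 3) (Fin 3) ℝ) (a : ℝ) (u : Fin 3 → ℝ) :
    quad C (a • u) = a ^ 2 * quad C u := by
  simp only [quad, Matrix.mulVec_smul, dotProduct_smul, smul_dotProduct, smul_eq_mul]
  ring

lemma quad_pencil (C₁ C₂ : Matrix (Fin 3) (Fin 3) ℝ) (ν : ℝ × ℝ) (u : Fin 3 → ℝ) :
    quad (pencil C₁ C₂ ν) u = ν.1 * quad C₁ u + ν.2 * quad C₂ u := by
  simp only [quad, pencil, Matrix.add_mulVec, Matrix.smul_mulVec, dotProduct_add, dotProduct_smul,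
    smul_eq_mul]

lemma chartDen_eq (M : Matrix (Fin 3) (Fin 3) ℝ) (x y : ℝ) :
    chartDen M x y = M 2 0 * x + M 2 1 * y + M 2 2 := by
  simp [chartDen, Matrix.mulVec, dotProduct, Fin.sum_univ_three]

lemma chart_eq (M : Matrix (Fin 3) (Fin 3) ℝ) (x y : ℝ) :
    chart M x y = ((M 0 0 * x + M 0 1 * y + M 0 2) / chartDen M x y,
      (M 1 0 * x + M 1 1 * y + M 1 2) / chartDen M x y) := by
  simp [chart, chartDen, dehomog, Matrix.mulVec, dotProduct, Fin.sum_univ_three]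

/-- This cross product is the determinant of the three homogeneous vectors with last coordinate 1,
so M multiplies it by its determinant and dehomogenizing divides by the three denominators. -/
lemma cross_chart {M : Matrix (Fin 3) (Fin 3) ℝ} {x₀ y₀ x₁ y₁ x₂ y₂ : ℝ}
    (h₀ : chartDen M x₀ y₀ ≠ 0) (h₁ : chartDen M x₁ y₁ ≠ 0) (h₂ : chartDen M x₂ y₂ ≠ 0) :
    cross (chart M x₁ y₁ - chart M x₀ y₀) (chart M x₂ y₂ - chart M x₀ y₀) =
      M.det / (chartDen M x₀ y₀ * chartDen M x₁ y₁ * chartDen M x₂ y₂) *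
        ((x₁ - x₀) * (y₂ - y₀) - (y₁ - y₀) * (x₂ - x₀)) := by
  simp only [chart_eq, cross, Prod.fst_sub, Prod.snd_sub, Matrix.det_fin_three]
  have e0 := chartDen_eq M x₀ y₀
  have e1 := chartDen_eq M x₁ y₁
  have e2 := chartDen_eq M x₂ y₂
  field_simp
  rw [e0, e1, e2]
  ring

/-- Points of a chord in the chart. -/
lemma chart_mem_segment {M : Matrix (Fin 3) (Fin 3) ℝ} {x₀ y₀ x₁ y₁ τ : ℝ}
    (h₀ : 0 < chartDen M x₀ y₀) (h₁ : 0 < chartDen M x₁ y₁) (hτ0 : 0 ≤ τ) (hτ1 : τ ≤ 1) :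
    chart M ((1 - τ) * x₀ + τ * x₁) ((1 - τ) * y₀ + τ * y₁) ∈
      segment ℝ (chart M x₀ y₀) (chart M x₁ y₁) := by
  have hd : chartDen M ((1 - τ) * x₀ + τ * x₁) ((1 - τ) * y₀ + τ * y₁) =
      (1 - τ) * chartDen M x₀ y₀ + τ * chartDen M x₁ y₁ := by
    simp only [chartDen_eq]; ring
  have hpos : 0 < (1 - τ) * chartDen M x₀ y₀ + τ * chartDen M x₁ y₁ := by
    rcases hτ0.eq_or_lt with rfl | hτ0
    · simpa using h₀
    · have := mul_pos hτ0 h₁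
      have := mul_nonneg (sub_nonneg.2 hτ1) h₀.le
      linarith
  -- A projective map reweights the endpoints of a segment by their denominators.
  refine ⟨(1 - τ) * chartDen M x₀ y₀ / ((1 - τ) * chartDen M x₀ y₀ + τ * chartDen M x₁ y₁),
    τ * chartDen M x₁ y₁ / ((1 - τ) * chartDen M x₀ y₀ + τ * chartDen M x₁ y₁),
    div_nonneg (mul_nonneg (sub_nonneg.2 hτ1) h₀.le) hpos.le,
    div_nonneg (mul_nonneg hτ0 h₁.le) hpos.le, ?_, ?_⟩
  · rw [← add_div, div_self hpos.ne']
  · rw [chart_eq, chart_eq, chart_eq, hd]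
    ext
    · simp only [Prod.fst_add, Prod.smul_fst, smul_eq_mul]
      field_simp
      ring
    · simp only [Prod.snd_add, Prod.smul_snd, smul_eq_mul]
      field_simp
      ring

lemma quad_homog_chart {M : Matrix (Fin 3) (Fin 3) ℝ} {x y : ℝ} (h : chartDen M x y ≠ 0)
    (C : Matrix (Fin 3) (Fin 3) ℝ) :
    quad C (homog (chart M x y)) = (chartDen M x y)⁻¹ ^ 2 * quad C (M *ᵥ ![x, y, 1]) := by
  rw [chart, homog_dehomog h, quad_smul]
  rfl

namespace DiagonalFrame
variable {C₁ C₂ M : Matrix (Fin 3) (Fin 3) ℝ} {l₁ l₂ l₃ : ℝ}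

/-- Reverse Cauchy-Schwarz inequality. -/
lemma forward_cone (hM : DiagonalFrame C₁ C₂ l₁ l₂ l₃ M) (X : Fin 3 → ℝ) :
    ((M *ᵥ X) 2) ^ 2 + M 2 2 ^ 2 * (X 2 ^ 2 - X 0 ^ 2 - X 1 ^ 2) ≤
      2 * M 2 2 * ((M *ᵥ X) 2) * X 2 := by
  set t := (M *ᵥ X) 2 with ht
  -- This combination of X and the apex is sent to the line at infinity, where C₁ is positive.
  have hw2 : (M *ᵥ (M 2 2 • X - t • ![0, 0, 1])) 2 = 0 := by
    rw [Matrix.mulVec_sub, Matrix.mulVec_smul, Matrix.mulVec_smul, Pi.sub_apply, Pi.smul_apply,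
      Pi.smul_apply, ← ht]
    simp [Matrix.mulVec, dotProduct, Fin.sum_univ_three]
    ring
  have hw : 0 ≤ quad C₁ (M *ᵥ (M 2 2 • X - t • ![0, 0, 1])) := by
    by_cases h : M *ᵥ (M 2 2 • X - t • ![0, 0, 1]) = 0
    · rw [h]; simp [quad]
    · exact (hM.pos _ hw2 h).le
  rw [hM.quad₁] at hw
  simp at hw
  linarith

/-- The line at infinity misses the closed disc, since C₁ is positive on it and nonpositive on the
disc; `forward_cone` rules out the negative sign. -/
lemma chartDen_pos (hM : DiagonalFrame C₁ C₂ l₁ l₂ l₃ M) {x y : ℝ} (h : x ^ 2 + y ^ 2 ≤ 1) :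
    0 < chartDen M x y := by
  have h1 := hM.forward_cone ![x, y, 1]
  simp only [Matrix.cons_val] at h1
  change (chartDen M x y) ^ 2 + _ ≤ 2 * M 2 2 * chartDen M x y * 1 at h1
  have hk := hM.apex_pos
  have h2 : 0 ≤ M 2 2 ^ 2 * (1 ^ 2 - x ^ 2 - y ^ 2) :=
    mul_nonneg (sq_nonneg _) (by linarith)
  have hne : chartDen M x y ≠ 0 := by
    intro h0
    have hX : M *ᵥ ![x, y, 1] ≠ 0 := by
      intro hX
      have hu := Matrix.eq_zero_of_mulVec_eq_zero hM.det_pos.ne' hX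
      have := congrFun hu 2
      simp at this
    have h3 := hM.pos _ h0 hX
    rw [hM.quad₁] at h3
    simp only [Matrix.cons_val] at h3
    linarith
  have : 0 < chartDen M x y ^ 2 := by positivity
  by_contra hn
  have := mul_nonneg hk.le (neg_nonneg.2 (not_lt.1 hn))
  linarith

lemma chart_mem_conic (hM : DiagonalFrame C₁ C₂ l₁ l₂ l₃ M) {x y : ℝ} (h : x ^ 2 + y ^ 2 = 1) :
    chart M x y ∈ conic C₁ := by
  change quad C₁ _ = 0
  rw [quad_homog_chart (hM.chartDen_pos h.le).ne', hM.quad₁]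
  simp [h]

lemma exists_chart (hM : DiagonalFrame C₁ C₂ l₁ l₂ l₃ M) {z : Plane}
    (hz : ∃ X, M *ᵥ X = homog z ∧ X 0 ^ 2 + X 1 ^ 2 ≤ X 2 ^ 2) :
    ∃ x y, x ^ 2 + y ^ 2 ≤ 1 ∧ chart M x y = z := by
  obtain ⟨X, hX, hle⟩ := hz
  have h1 := hM.forward_cone X
  have ht : (M *ᵥ X) 2 = 1 := by rw [hX]; rfl
  rw [ht] at h1
  have hX2 : 0 < X 2 := by
    by_contra hn
    have := mul_nonneg hM.apex_pos.le (neg_nonneg.2 (not_lt.1 hn))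
    have := mul_nonneg (sq_nonneg (M 2 2)) (by linarith : 0 ≤ X 2 ^ 2 - X 0 ^ 2 - X 1 ^ 2)
    linarith
  refine ⟨X 0 / X 2, X 1 / X 2, ?_, ?_⟩
  · rw [div_pow, div_pow, ← add_div, div_le_one (by positivity)]
    exact hle
  · have : ![X 0 / X 2, X 1 / X 2, 1] = (X 2)⁻¹ • X := by
      ext i; fin_cases i <;> simp [hX2.ne', div_eq_inv_mul]
    rw [chart, this, Matrix.mulVec_smul, dehomog_smul (inv_ne_zero hX2.ne'), hX, dehomog_homog]

lemma exists_mulVec_eq (hM : DiagonalFrame C₁ C₂ l₁ l₂ l₃ M) (u : Fin 3 → ℝ) :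
    ∃ X, M *ᵥ X = u := by
  refine ⟨M⁻¹ *ᵥ u, ?_⟩
  rw [Matrix.mulVec_mulVec, Matrix.mul_nonsing_inv _ (isUnit_iff_ne_zero.2 hM.det_pos.ne'),
    Matrix.one_mulVec]

lemma exists_chart_of_mem_conic (hM : DiagonalFrame C₁ C₂ l₁ l₂ l₃ M) {z : Plane}
    (hz : z ∈ conic C₁) : ∃ x y, x ^ 2 + y ^ 2 = 1 ∧ chart M x y = z := by
  obtain ⟨X, hX⟩ := hM.exists_mulVec_eq (homog z)
  have h1 : quad C₁ (homog z) = 0 := hz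
  have h2 := h1
  rw [← hX, hM.quad₁] at h2
  obtain ⟨x, y, hxy, rfl⟩ := hM.exists_chart ⟨X, hX, by linarith⟩
  refine ⟨x, y, ?_, rfl⟩
  have hd := (hM.chartDen_pos hxy).ne'
  rw [quad_homog_chart hd, hM.quad₁] at h1
  have := (mul_eq_zero.1 h1).resolve_left (pow_ne_zero _ (inv_ne_zero hd))
  simp only [Matrix.cons_val] at this
  linarith

/-- In the chart, the conic of the pencil element with parameter `ν` is the ellipse with squared
semiaxes `p` and `r`. -/
lemma conic_pencil_eq (hM : DiagonalFrame C₁ C₂ l₁ l₂ l₃ M) (h12 : l₂ < l₁) (h23 : l₃ < l₂)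
    {ν : ℝ × ℝ} (hν : ValidParam l₃ ν) {p r : ℝ}
    (hp : p * (ν.1 + l₁ * ν.2) = ν.1 + l₃ * ν.2) (hr : r * (ν.1 + l₂ * ν.2) = ν.1 + l₃ * ν.2)
    (hpr : NestedAxes p r) :
    conic (pencil C₁ C₂ ν) =
      (fun X : ℝ × ℝ => chart M X.1 X.2) '' {X | r * X.1 ^ 2 + p * X.2 ^ 2 = p * r} := by
  obtain ⟨hν2, hc⟩ := hν
  have hb : 0 < ν.1 + l₂ * ν.2 := by nlinarith
  have ha : 0 < ν.1 + l₁ * ν.2 := by nlinarith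
  have hq : ∀ X : Fin 3 → ℝ, quad (pencil C₁ C₂ ν) (M *ᵥ X) = (ν.1 + l₁ * ν.2) * X 0 ^ 2 +
      (ν.1 + l₂ * ν.2) * X 1 ^ 2 - (ν.1 + l₃ * ν.2) * X 2 ^ 2 := fun X => by
    rw [quad_pencil, hM.quad₁, hM.quad₂]; ring
  have hiff : ∀ x y : ℝ, x ^ 2 + y ^ 2 ≤ 1 →
      (chart M x y ∈ conic (pencil C₁ C₂ ν) ↔ r * x ^ 2 + p * y ^ 2 = p * r) := by
    intro x y hxy
    have hd := (hM.chartDen_pos hxy).ne'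
    change quad _ _ = 0 ↔ _
    rw [quad_homog_chart hd, hq, mul_eq_zero, or_iff_right (pow_ne_zero _ (inv_ne_zero hd))]
    simp only [Matrix.cons_val]
    have key : (ν.1 + l₃ * ν.2) * (r * x ^ 2 + p * y ^ 2 - p * r) = p * r *
        ((ν.1 + l₁ * ν.2) * x ^ 2 + (ν.1 + l₂ * ν.2) * y ^ 2 - (ν.1 + l₃ * ν.2) * 1 ^ 2) := by
      linear_combination (-r * x ^ 2) * hp + (-p * y ^ 2) * hr
    have hprn : p * r ≠ 0 := (mul_pos hpr.pos (hpr.pos.trans hpr.lt)).ne'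
    constructor <;> intro h
    · rw [h, mul_zero] at key
      have := (mul_eq_zero.1 key).resolve_left hc.ne'
      linarith
    · rw [h, sub_self, mul_zero] at key
      exact (mul_eq_zero.1 key.symm).resolve_left hprn
  ext z
  constructor
  · intro hz
    obtain ⟨X, hX⟩ := hM.exists_mulVec_eq (homog z)
    have h1 : quad (pencil C₁ C₂ ν) (homog z) = 0 := hz
    rw [← hX, hq] at h1
    obtain ⟨x, y, hxy, rfl⟩ := hM.exists_chart ⟨X, hX, by
      -- l₃ is the smallest eigenvalue, so the conic lies in the cone over the disc.
      have h2 : (ν.1 + l₃ * ν.2) * (X 0 ^ 2 + X 1 ^ 2) ≤ (ν.1 + l₃ * ν.2) * X 2 ^ 2 := by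
        have := mul_nonneg (mul_nonneg (by linarith : 0 ≤ l₁ - l₃) hν2.le) (sq_nonneg (X 0))
        have := mul_nonneg (mul_nonneg (by linarith : 0 ≤ l₂ - l₃) hν2.le) (sq_nonneg (X 1))
        linarith
      exact le_of_mul_le_mul_left h2 hc⟩
    exact ⟨(x, y), (hiff x y hxy).1 hz, rfl⟩
  · rintro ⟨⟨x, y⟩, hxy, rfl⟩
    have hxy : r * x ^ 2 + p * y ^ 2 = p * r := hxy
    refine (hiff x y ?_).2 hxy
    have h1 : p * (x ^ 2 + y ^ 2) ≤ p * 1 := by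
      have := mul_nonneg (sub_nonneg.2 hpr.lt.le) (sq_nonneg x)
      have := mul_pos hpr.pos (sub_pos.2 hpr.lt_one)
      linarith
    exact le_of_mul_le_mul_left h1 hpr.pos

/-- The counterclockwise angular parametrization of the outer conic. -/
noncomputable def circ (hM : DiagonalFrame C₁ C₂ l₁ l₂ l₃ M) (φ : ℝ) : conic C₁ :=
  ⟨chart M (Real.cos φ) (Real.sin φ), hM.chart_mem_conic (Real.cos_sq_add_sin_sq φ)⟩

lemma continuous_circ (hM : DiagonalFrame C₁ C₂ l₁ l₂ l₃ M) : Continuous hM.circ := by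
  refine Continuous.subtype_mk ?_ _
  have hd : ∀ φ, chartDen M (Real.cos φ) (Real.sin φ) ≠ 0 := fun φ =>
    (hM.chartDen_pos (Real.cos_sq_add_sin_sq φ).le).ne'
  have hc : Continuous fun φ => chartDen M (Real.cos φ) (Real.sin φ) := by
    simp only [chartDen_eq]; fun_prop
  simp only [chart_eq]
  exact (Continuous.div (by fun_prop) hc hd).prodMk (Continuous.div (by fun_prop) hc hd)

lemma surjective_circ (hM : DiagonalFrame C₁ C₂ l₁ l₂ l₃ M) : Function.Surjective hM.circ := by
  rintro ⟨z, hz⟩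
  obtain ⟨x, y, hxy, rfl⟩ := hM.exists_chart_of_mem_conic hz
  have h1 : -1 ≤ x := by nlinarith [sq_nonneg y]
  have h2 : x ≤ 1 := by nlinarith [sq_nonneg y]
  have h3 : √(1 - x ^ 2) = |y| := by
    rw [← Real.sqrt_sq_eq_abs]; congr 1; linarith
  rcases le_total 0 y with hy | hy
  · refine ⟨Real.arccos x, Subtype.ext ?_⟩
    simp only [circ]
    rw [Real.cos_arccos h1 h2, Real.sin_arccos, h3, abs_of_nonneg hy]
  · refine ⟨-Real.arccos x, Subtype.ext ?_⟩
    simp only [circ]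
    rw [Real.cos_neg, Real.sin_neg, Real.cos_arccos h1 h2, Real.sin_arccos, h3, abs_of_nonpos hy,
      neg_neg]

lemma circ_add_two_pi (hM : DiagonalFrame C₁ C₂ l₁ l₂ l₃ M) (φ : ℝ) :
    hM.circ (φ + 2 * Real.pi) = hM.circ φ := by
  simp only [circ, Real.cos_add_two_pi, Real.sin_add_two_pi]

/-- For points of the unit circle the cross product is four times the product of the sines of the
half-differences, all in (0, π). -/
lemma cross_circ_pos (hM : DiagonalFrame C₁ C₂ l₁ l₂ l₃ M) {α β γ : ℝ} (h1 : α < β) (h2 : β < γ)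
    (h3 : γ < α + 2 * Real.pi) :
    0 < cross ((hM.circ β : Plane) - hM.circ α) ((hM.circ γ : Plane) - hM.circ α) := by
  have hd : ∀ φ, 0 < chartDen M (Real.cos φ) (Real.sin φ) := fun φ =>
    hM.chartDen_pos (Real.cos_sq_add_sin_sq φ).le
  simp only [circ]
  rw [cross_chart (hd _).ne' (hd _).ne' (hd _).ne']
  refine mul_pos (div_pos hM.det_pos (mul_pos (mul_pos (hd _) (hd _)) (hd _))) ?_
  have key : (Real.cos β - Real.cos α) * (Real.sin γ - Real.sin α) -
      (Real.sin β - Real.sin α) * (Real.cos γ - Real.cos α) =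
      4 * Real.sin ((β - α) / 2) * Real.sin ((γ - α) / 2) * Real.sin ((γ - β) / 2) := by
    rw [Real.cos_sub_cos, Real.cos_sub_cos, Real.sin_sub_sin, Real.sin_sub_sin,
      show (γ - β) / 2 = (γ + α) / 2 - (β + α) / 2 by ring, Real.sin_sub ((γ + α) / 2)]
    ring
  rw [key]
  have s1 := Real.sin_pos_of_pos_of_lt_pi (x := (β - α) / 2) (by linarith) (by linarith)
  have s2 := Real.sin_pos_of_pos_of_lt_pi (x := (γ - α) / 2) (by linarith) (by linarith)
  have s3 := Real.sin_pos_of_pos_of_lt_pi (x := (γ - β) / 2) (by linarith) (by linarith)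
  positivity

/-- The parametrization of the outer conic by normalized elliptic length is counterclockwise. -/
lemma isPositiveParam (hM : DiagonalFrame C₁ C₂ l₁ l₂ l₃ M) {e : ℝ} (he : e ^ 2 < 1) :
    IsPositiveParam (conic C₁) fun t => hM.circ (jacobiAm he (4 * ellipticK e * t)) where
  continuous := hM.continuous_circ.comp ((jacobiAm he).continuous.comp (by fun_prop))
  periodic t := by
    rw [mul_add, mul_one, jacobiAm_add_four_ellipticK, hM.circ_add_two_pi]
  surjective := by
    have hK := ellipticK_pos he
    refine hM.surjective_circ.comp ((jacobiAm he).surjective.comp fun x => ?_)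
    exact ⟨x / (4 * ellipticK e), by field_simp⟩
  oriented s t u hst htu hus := by
    have hK : 0 < 4 * ellipticK e := by linarith [ellipticK_pos he]
    refine hM.cross_circ_pos ?_ ?_ ?_
    · exact (jacobiAm he).strictMono (mul_lt_mul_of_pos_left hst hK)
    · exact (jacobiAm he).strictMono (mul_lt_mul_of_pos_left htu hK)
    · rw [← jacobiAm_add_four_ellipticK he]
      apply (jacobiAm he).strictMono
      have := mul_lt_mul_of_pos_left hus hK
      linarith

end DiagonalFrame

/-! ### Tangency and the Poncelet step -/

/-- The chord has length 2 sin δ and lies on x cos s + y sin s = cos δ, so the cross product is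
length times signed distance. -/
lemma cross_chord (s δ x y : ℝ) :
    (Real.cos (s + δ) - Real.cos (s - δ)) * (y - Real.sin (s - δ)) -
      (Real.sin (s + δ) - Real.sin (s - δ)) * (x - Real.cos (s - δ)) =
    2 * Real.sin δ * (Real.cos δ - (x * Real.cos s + y * Real.sin s)) := by
  have h := Real.sin_sq_add_cos_sq s
  simp only [Real.cos_add, Real.cos_sub, Real.sin_add, Real.sin_sub]
  linear_combination (2 * Real.sin δ * Real.cos δ) * h

namespace NestedAxes
variable {p r : ℝ}

/-- Cauchy-Schwarz, with the defect written as a square. -/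
lemma support_bound (h : NestedAxes p r) {x y : ℝ} (hxy : r * x ^ 2 + p * y ^ 2 = p * r) (s : ℝ) :
    x * Real.cos s + y * Real.sin s ≤ √(supportSq p r s) := by
  apply Real.le_sqrt_of_sq_le
  have hpr : 0 < p * r := mul_pos h.pos (h.pos.trans h.lt)
  have key : p * r * supportSq p r s - p * r * (x * Real.cos s + y * Real.sin s) ^ 2 =
      (r * x * Real.sin s - p * y * Real.cos s) ^ 2 := by
    unfold supportSq
    linear_combination (-(p * Real.cos s ^ 2 + r * Real.sin s ^ 2)) * hxy
  nlinarith [sq_nonneg (r * x * Real.sin s - p * y * Real.cos s)]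

lemma contact_mem (h : NestedAxes p r) (s : ℝ) :
    r * (p * Real.cos s / √(supportSq p r s)) ^ 2 +
      p * (r * Real.sin s / √(supportSq p r s)) ^ 2 = p * r := by
  have hpos := h.supportSq_pos s
  rw [div_pow, div_pow, Real.sq_sqrt hpos.le]
  field_simp
  unfold supportSq
  ring

lemma contact_support (h : NestedAxes p r) (s : ℝ) :
    p * Real.cos s / √(supportSq p r s) * Real.cos s +
      r * Real.sin s / √(supportSq p r s) * Real.sin s = √(supportSq p r s) := by
  have hpos := Real.sqrt_pos.2 (h.supportSq_pos s)
  have h2 := Real.sq_sqrt (h.supportSq_pos s).le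
  field_simp
  rw [h2]
  unfold supportSq
  ring

lemma sq_add_sq_lt_one (h : NestedAxes p r) {x y : ℝ} (hxy : r * x ^ 2 + p * y ^ 2 = p * r) :
    x ^ 2 + y ^ 2 < 1 := by
  have h1 : p * (x ^ 2 + y ^ 2) < p * 1 := by
    have := mul_nonneg (sub_nonneg.2 h.lt.le) (sq_nonneg x)
    have := mul_pos h.pos (sub_pos.2 h.lt_one)
    linarith
  exact lt_of_mul_lt_mul_left h1 h.pos.le

/-- The contact point divides the tangent chord internally. -/
lemma exists_contact_ratio (h : NestedAxes p r) (s : ℝ) : ∃ τ : ℝ, 0 ≤ τ ∧ τ ≤ 1 ∧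
    (1 - τ) * Real.cos (s - halfChord p r s) + τ * Real.cos (s + halfChord p r s) =
      p * Real.cos s / √(supportSq p r s) ∧
    (1 - τ) * Real.sin (s - halfChord p r s) + τ * Real.sin (s + halfChord p r s) =
      r * Real.sin s / √(supportSq p r s) := by
  have hab := abs_lt.1 (h.abs_contact_lt s)
  have hH := Real.sqrt_pos.2 (h.supportSq_pos s)
  have hS := Real.sqrt_pos.2 (sub_pos.2 (h.supportSq_lt_one s))
  have hH2 : √(supportSq p r s) ^ 2 = p * Real.cos s ^ 2 + r * Real.sin s ^ 2 :=
    Real.sq_sqrt (h.supportSq_pos s).le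
  have hsc := Real.sin_sq_add_cos_sq s
  rw [Real.cos_sub, Real.cos_add, Real.sin_sub, Real.sin_add, h.cos_halfChord, h.sin_halfChord]
  set H := √(supportSq p r s)
  set S := √(1 - supportSq p r s)
  set a := Real.sin s
  set b := Real.cos s
  have hHS : 0 < 2 * (H * S) := by positivity
  -- Along the chord, measured from its midpoint, the endpoints are at ∓S and the contact point is
  -- at (r - p) sin s cos s / H.
  refine ⟨(H * S + (r - p) * a * b) / (2 * (H * S)), div_nonneg (by linarith [hab.1]) hHS.le,
    (div_le_one hHS).2 (by linarith [hab.2]), ?_, ?_⟩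
  · field_simp
    linear_combination 2 * S * b * hH2 + 2 * S * b * p * hsc
  · field_simp
    linear_combination 2 * S * a * hH2 + 2 * S * a * r * hsc

end NestedAxes

namespace DiagonalFrame
variable {C₁ C₂ M : Matrix (Fin 3) (Fin 3) ℝ} {l₁ l₂ l₃ : ℝ}

lemma cross_circ_chart (hM : DiagonalFrame C₁ C₂ l₁ l₂ l₃ M) {x y : ℝ}
    (hxy : x ^ 2 + y ^ 2 ≤ 1) (s δ : ℝ) : ∃ κ : ℝ, 0 < κ ∧
    cross ((hM.circ (s + δ) : Plane) - hM.circ (s - δ)) (chart M x y - hM.circ (s - δ)) =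
      κ * (2 * Real.sin δ * (Real.cos δ - (x * Real.cos s + y * Real.sin s))) := by
  have hd : ∀ φ, 0 < chartDen M (Real.cos φ) (Real.sin φ) := fun φ =>
    hM.chartDen_pos (Real.cos_sq_add_sin_sq φ).le
  have hd' := hM.chartDen_pos hxy
  refine ⟨_, div_pos hM.det_pos (mul_pos (mul_pos (hd (s - δ)) (hd (s + δ))) hd'), ?_⟩
  simp only [circ]
  rw [cross_chart (hd _).ne' (hd _).ne' hd'.ne', cross_chord]

/-- A tangent chord of the inner ellipse is a Poncelet step. -/
lemma ponceletStep_halfChord (hM : DiagonalFrame C₁ C₂ l₁ l₂ l₃ M) {p r : ℝ} (h : NestedAxes p r)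
    (s : ℝ) :
    PonceletStep ((fun X : ℝ × ℝ => chart M X.1 X.2) '' {X | r * X.1 ^ 2 + p * X.2 ^ 2 = p * r})
      (hM.circ (s - halfChord p r s)) (hM.circ (s + halfChord p r s)) := by
  have hδ0 := h.halfChord_pos s
  have hδ1 := h.halfChord_lt s
  have hd : ∀ φ, 0 < chartDen M (Real.cos φ) (Real.sin φ) := fun φ =>
    hM.chartDen_pos (Real.cos_sq_add_sin_sq φ).le
  refine ⟨fun heq => ?_, ?_, ?_⟩
  · have := hM.cross_circ_pos (α := s - halfChord p r s) (β := s + halfChord p r s)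
      (γ := s + Real.pi) (by linarith) (by linarith) (by linarith)
    simp [heq, cross] at this
  · obtain ⟨τ, hτ0, hτ1, hx, hy⟩ := h.exists_contact_ratio s
    refine ⟨_, ⟨(_, _), h.contact_mem s, rfl⟩, ?_⟩
    simp only [circ]
    rw [← hx, ← hy]
    exact chart_mem_segment (hd _) (hd _) hτ0 hτ1
  · rintro _ ⟨⟨x, y⟩, hxy, rfl⟩
    obtain ⟨κ, hκ, heq⟩ := hM.cross_circ_chart (h.sq_add_sq_lt_one hxy).le s (halfChord p r s)
    rw [heq, h.cos_halfChord]
    have h1 := Real.sin_pos_of_pos_of_lt_pi hδ0 (by linarith)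
    have h2 := h.support_bound hxy s
    exact mul_nonneg hκ.le (mul_nonneg (by linarith) (by linarith))

/-- Every Poncelet step is a tangent chord of the inner ellipse. -/
lemma halfChord_eq_of_ponceletStep (hM : DiagonalFrame C₁ C₂ l₁ l₂ l₃ M) {p r : ℝ}
    (h : NestedAxes p r) {s δ : ℝ} (hδ0 : 0 < δ) (hδ1 : δ < Real.pi)
    (hstep : PonceletStep
      ((fun X : ℝ × ℝ => chart M X.1 X.2) '' {X | r * X.1 ^ 2 + p * X.2 ^ 2 = p * r})
      (hM.circ (s - δ)) (hM.circ (s + δ))) : halfChord p r s = δ := by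
  obtain ⟨-, ⟨w, ⟨⟨x, y⟩, hxy, hw⟩, α, β, -, -, hαβ, hseg⟩, hall⟩ := hstep
  simp only at hw
  subst hw
  have hsin := Real.sin_pos_of_pos_of_lt_pi hδ0 hδ1
  -- The ellipse point with outer normal s lies on the left of the chord.
  have hle : √(supportSq p r s) ≤ Real.cos δ := by
    have hT := h.contact_mem s
    have h1 := hall _ ⟨(_, _), hT, rfl⟩
    obtain ⟨κ, hκ, heq⟩ := hM.cross_circ_chart (h.sq_add_sq_lt_one hT).le s δ
    rw [heq, h.contact_support] at h1
    have h2 := nonneg_of_mul_nonneg_right h1 hκ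
    have h3 := nonneg_of_mul_nonneg_right h2 (by linarith)
    linarith
  -- Conversely, some ellipse point lies on the chord, where x cos s + y sin s = cos δ.
  have hge : Real.cos δ ≤ √(supportSq p r s) := by
    obtain ⟨κ, hκ, heq⟩ := hM.cross_circ_chart (h.sq_add_sq_lt_one hxy).le s δ
    have h0 : cross ((hM.circ (s + δ) : Plane) - hM.circ (s - δ))
        (chart M x y - hM.circ (s - δ)) = 0 := by
      rw [← hseg]
      have hα : α = 1 - β := by linarith
      simp only [cross, hα, Prod.fst_sub, Prod.snd_sub, Prod.fst_add, Prod.snd_add, Prod.smul_fst,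
        Prod.smul_snd, smul_eq_mul]
      ring
    rw [h0] at heq
    have h1 := (mul_eq_zero.1 heq.symm).resolve_left hκ.ne'
    have h2 := (mul_eq_zero.1 h1).resolve_left (by positivity)
    linarith [h.support_bound hxy s]
  rw [halfChord, le_antisymm hle hge, Real.arccos_cos hδ0.le hδ1.le]

/-- In the parametrization by elliptic length, the Poncelet map is a rotation. -/
lemma ponceletMap_circ (hM : DiagonalFrame C₁ C₂ l₁ l₂ l₃ M) {p r e : ℝ} (h : NestedAxes p r)
    (he1 : e ^ 2 < 1) (he : e ^ 2 * (r * (1 - p)) = r - p) (t : ℝ) :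
    ponceletMap (conic C₁)
      ((fun X : ℝ × ℝ => chart M X.1 X.2) '' {X | r * X.1 ^ 2 + p * X.2 ^ 2 = p * r})
      (hM.circ (jacobiAm he1 (4 * ellipticK e * t))) =
    hM.circ (jacobiAm he1 (4 * ellipticK e *
      (t + ellipticF (Real.arccos √p) e / (2 * ellipticK e)))) := by
  have hK := ellipticK_pos he1
  set Ci := (fun X : ℝ × ℝ => chart M X.1 X.2) '' {X | r * X.1 ^ 2 + p * X.2 ^ 2 = p * r}
  set φ := jacobiAm he1 (4 * ellipticK e * t) with hφ
  have hFφ : ellipticF φ e = 4 * ellipticK e * t := ellipticF_jacobiAm he1 _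
  have hψ : ∀ ψ, ellipticF ψ e - ellipticF φ e = 2 * ellipticF (Real.arccos √p) e →
      jacobiAm he1 (4 * ellipticK e *
        (t + ellipticF (Real.arccos √p) e / (2 * ellipticK e))) = ψ := by
    intro ψ hψ
    rw [← jacobiAm_ellipticF he1 ψ]
    congr 1
    rw [hFφ] at hψ
    field_simp
    linarith
  obtain ⟨s, hs⟩ := h.exists_sub_halfChord φ
  have hstep : PonceletStep Ci (hM.circ φ) (hM.circ (jacobiAm he1 (4 * ellipticK e *
      (t + ellipticF (Real.arccos √p) e / (2 * ellipticK e))))) := by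
    rw [hψ (s + halfChord p r s) (by rw [← hs]; exact h.ellipticF_add_halfChord_sub he1 he s), ← hs]
    exact hM.ponceletStep_halfChord h s
  have huniq : ∀ w : conic C₁, PonceletStep Ci (hM.circ φ) w →
      w = hM.circ (jacobiAm he1 (4 * ellipticK e *
      (t + ellipticF (Real.arccos √p) e / (2 * ellipticK e)))) := by
    intro w hw
    -- Taking t' within one period puts ψ in (φ, φ + 2π), so the half-difference is in (0, π) and
    -- the chord has the form s ± δ.
    obtain ⟨t', ht1, ht2, rfl⟩ := (hM.isPositiveParam he1).exists_mem_Ico t w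
    have htt : t < t' := by
      refine lt_of_le_of_ne ht1 ?_
      rintro rfl
      exact hw.1 rfl
    set ψ := jacobiAm he1 (4 * ellipticK e * t')
    have hlt : φ < ψ := (jacobiAm he1).strictMono (mul_lt_mul_of_pos_left htt (by linarith))
    have hlt2 : ψ < φ + 2 * Real.pi := by
      rw [hφ, ← jacobiAm_add_four_ellipticK he1]
      apply (jacobiAm he1).strictMono
      have := mul_lt_mul_of_pos_left ht2 (by linarith : 0 < 4 * ellipticK e)
      linarith
    have e1 : φ = (φ + ψ) / 2 - (ψ - φ) / 2 := by ring
    have e2 : ψ = (φ + ψ) / 2 + (ψ - φ) / 2 := by ring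
    have hδ : halfChord p r ((φ + ψ) / 2) = (ψ - φ) / 2 := by
      apply hM.halfChord_eq_of_ponceletStep h (by linarith) (by linarith)
      rw [← e1, ← e2]
      exact hw
    have hF := h.ellipticF_add_halfChord_sub he1 he ((φ + ψ) / 2)
    rw [hδ, ← e1, ← e2] at hF
    rw [hψ ψ hF]
  have hex : ∃! w : conic C₁, PonceletStep Ci (hM.circ φ) w := ⟨_, hstep, huniq⟩
  rw [ponceletMap, dif_pos hex]
  exact huniq _ hex.choose_spec.1

end DiagonalFrame

/-! ### Dependence on the pencil parameter -/

section Pencil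
variable {l₁ l₂ l₃ : ℝ} {ν μ : ℝ × ℝ}

lemma pencilEcc_sq (h12 : l₂ < l₁) (h23 : l₃ < l₂) :
    pencilEcc l₁ l₂ l₃ ^ 2 = (l₁ - l₂) / (l₁ - l₃) :=
  Real.sq_sqrt (div_nonneg (by linarith) (by linarith))

lemma pencilEcc_sq_lt_one (h12 : l₂ < l₁) (h23 : l₃ < l₂) : pencilEcc l₁ l₂ l₃ ^ 2 < 1 := by
  rw [pencilEcc_sq h12 h23, div_lt_one (by linarith)]
  linarith

lemma ValidParam.coeff_pos (hν : ValidParam l₃ ν) {l : ℝ} (hl : l₃ ≤ l) : 0 < ν.1 + l * ν.2 := by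
  obtain ⟨h1, h2⟩ := hν
  have := mul_le_mul_of_nonneg_right hl h1.le
  linarith

lemma ValidParam.nestedAxes (hν : ValidParam l₃ ν) (h12 : l₂ < l₁) (h23 : l₃ < l₂) :
    NestedAxes ((ν.1 + l₃ * ν.2) / (ν.1 + l₁ * ν.2)) ((ν.1 + l₃ * ν.2) / (ν.1 + l₂ * ν.2)) := by
  have hb := hν.coeff_pos h23.le
  have ha := hν.coeff_pos (h23.trans h12).le
  have hab := mul_lt_mul_of_pos_right h12 hν.1
  have hbc := mul_lt_mul_of_pos_right h23 hν.1
  exact ⟨div_pos hν.2 ha, div_lt_div_of_pos_left hν.2 hb (by linarith),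
    (div_lt_one hb).2 (by linarith)⟩

lemma omega_eq (hν : ValidParam l₃ ν) (h13 : l₃ < l₁) :
    omega l₁ l₃ ν = Real.arccos √((ν.1 + l₃ * ν.2) / (ν.1 + l₁ * ν.2)) := by
  have ha := hν.coeff_pos h13.le
  rw [Real.arccos_eq_arcsin (Real.sqrt_nonneg _), Real.sq_sqrt (div_nonneg hν.2.le ha.le), omega]
  congr 2
  rw [add_comm (l₁ * ν.2), eq_sub_iff_add_eq, ← add_div, div_eq_one_iff_eq ha.ne']
  ring

/-- cos² ω is a fractional linear function of the parameter, and cross-multiplying two of its values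
leaves (l₁ - l₃)(ν × μ). -/
lemma omega_lt_omega_iff (hν : ValidParam l₃ ν) (hμ : ValidParam l₃ μ) (h13 : l₃ < l₁) :
    omega l₁ l₃ ν < omega l₁ l₃ μ ↔ 0 < cross ν μ := by
  have ha := hν.coeff_pos h13.le
  have ha' := hμ.coeff_pos h13.le
  have hle : ∀ κ : ℝ × ℝ, ValidParam l₃ κ →
      √((κ.1 + l₃ * κ.2) / (κ.1 + l₁ * κ.2)) ∈ Set.Icc (-1 : ℝ) 1 := by
    intro κ hκ
    refine ⟨by linarith [Real.sqrt_nonneg ((κ.1 + l₃ * κ.2) / (κ.1 + l₁ * κ.2))],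
      Real.sqrt_le_iff.2 ⟨zero_le_one, ?_⟩⟩
    rw [one_pow, div_le_one (hκ.coeff_pos h13.le)]
    have := mul_le_mul_of_nonneg_right h13.le hκ.1.le
    linarith
  rw [omega_eq hν h13, omega_eq hμ h13, Real.strictAntiOn_arccos.lt_iff_gt (hle ν hν) (hle μ hμ),
    Real.sqrt_lt_sqrt_iff (div_nonneg hμ.2.le ha'.le), div_lt_div_iff₀ ha' ha]
  have key : (ν.1 + l₃ * ν.2) * (μ.1 + l₁ * μ.2) - (μ.1 + l₃ * μ.2) * (ν.1 + l₁ * ν.2) =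
      (l₁ - l₃) * cross ν μ := by
    unfold cross; ring
  rw [← sub_pos, key, mul_pos_iff_of_pos_left (by linarith)]

end Pencil

variable {C₁ C₂ : Matrix (Fin 3) (Fin 3) ℝ} {l₁ l₂ l₃ : ℝ} {ν μ : ℝ × ℝ}

/-- The rotation number of a Poncelet map in terms of elliptic integrals. -/
lemma StandingAssumptions.rho_eq (hC : StandingAssumptions C₁ C₂ l₁ l₂ l₃)
    (hν : ValidParam l₃ ν) :
    rho C₁ C₂ ν = ellipticF (omega l₁ l₃ ν) (pencilEcc l₁ l₂ l₃) /
      (2 * ellipticK (pencilEcc l₁ l₂ l₃)) := by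
  obtain ⟨M, hM⟩ := hC.exists_diagonalFrame
  have h12 := hC.lt₁₂
  have h23 := hC.lt₂₃
  have h := hν.nestedAxes h12 h23
  have ha := hν.coeff_pos (h23.trans h12).le
  have hb := hν.coeff_pos h23.le
  have he1 := pencilEcc_sq_lt_one h12 h23
  -- Jacobi's modulus for this ellipse is the eccentricity of the pencil, independent of ν.
  have he : pencilEcc l₁ l₂ l₃ ^ 2 * ((ν.1 + l₃ * ν.2) / (ν.1 + l₂ * ν.2) *
      (1 - (ν.1 + l₃ * ν.2) / (ν.1 + l₁ * ν.2))) =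
      (ν.1 + l₃ * ν.2) / (ν.1 + l₂ * ν.2) - (ν.1 + l₃ * ν.2) / (ν.1 + l₁ * ν.2) := by
    rw [pencilEcc_sq h12 h23]
    have : l₁ - l₃ ≠ 0 := by linarith
    field_simp
    ring
  have hK := ellipticK_pos he1
  have hpi := Real.arccos_pos.2 ((Real.sqrt_lt' one_pos).2
    (by rw [one_pow]; exact h.lt.trans h.lt_one))
  rw [rho, hM.conic_pencil_eq h12 h23 hν (div_mul_cancel₀ _ ha.ne') (div_mul_cancel₀ _ hb.ne') h,
    omega_eq hν (h23.trans h12)]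
  refine rotationNumber_eq_of_translate (hM.isPositiveParam he1)
    (div_nonneg (ellipticF_pos he1 hpi).le (by linarith)) ?_ (hM.ponceletMap_circ h he1 he)
  rw [div_lt_one (by linarith)]
  -- ω ≤ π/2, so the rotation number is at most 1/2.
  have : ellipticF (Real.arccos √((ν.1 + l₃ * ν.2) / (ν.1 + l₁ * ν.2))) (pencilEcc l₁ l₂ l₃) ≤
      ellipticK (pencilEcc l₁ l₂ l₃) :=
    (strictMono_ellipticF he1).monotone (Real.arccos_le_pi_div_two.2 (Real.sqrt_nonneg _))
  linarith

lemma StandingAssumptions.conic_subset_conicInt_iff (hC : StandingAssumptions C₁ C₂ l₁ l₂ l₃)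
    (hμ : ValidParam l₃ μ) :
    conic (pencil C₁ C₂ μ) ⊆ conicInt (pencil C₁ C₂ ν) ↔ 0 < cross ν μ := by
  obtain ⟨M, hM⟩ := hC.exists_diagonalFrame
  have h12 := hC.lt₁₂
  have h23 := hC.lt₂₃
  have h := hμ.nestedAxes h12 h23
  have ha := hμ.coeff_pos (h23.trans h12).le
  have hb := hμ.coeff_pos h23.le
  have hset := hM.conic_pencil_eq h12 h23 hμ (div_mul_cancel₀ _ ha.ne') (div_mul_cancel₀ _ hb.ne') h
  have hneg : ∀ z ∈ conic (pencil C₁ C₂ μ), quad C₁ (homog z) < 0 := by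
    intro z hz
    rw [hset] at hz
    obtain ⟨⟨x, y⟩, hxy, rfl⟩ := hz
    have hlt := h.sq_add_sq_lt_one hxy
    have hd := hM.chartDen_pos hlt.le
    simp only
    rw [quad_homog_chart hd.ne', hM.quad₁]
    refine mul_neg_of_pos_of_neg (by positivity) ?_
    simp only [Matrix.cons_val]
    linarith
  -- The equation of the conic of μ eliminates C₂ from the form of ν.
  have key : ∀ z ∈ conic (pencil C₁ C₂ μ),
      μ.2 * quad (pencil C₁ C₂ ν) (homog z) = cross ν μ * quad C₁ (homog z) := by
    intro z hz
    have hz : quad (pencil C₁ C₂ μ) (homog z) = 0 := hz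
    rw [quad_pencil] at hz ⊢
    unfold cross
    linear_combination ν.2 * hz
  constructor
  · intro hsub
    obtain ⟨z, hz⟩ : (conic (pencil C₁ C₂ μ)).Nonempty := by
      rw [hset]
      exact ⟨_, ⟨(_, _), h.contact_mem 0, rfl⟩⟩
    have h1 : quad (pencil C₁ C₂ ν) (homog z) < 0 := hsub hz
    have h2 := mul_neg_of_pos_of_neg hμ.1 h1
    rw [key _ hz] at h2
    exact pos_of_mul_neg_left h2 (hneg _ hz).le
  · intro hcr z hz
    have h1 := mul_neg_of_pos_of_neg hcr (hneg z hz)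
    rw [← key z hz] at h1
    exact neg_of_mul_neg_right h1 hμ.1.le

lemma StandingAssumptions.rho_lt_rho_iff (hC : StandingAssumptions C₁ C₂ l₁ l₂ l₃)
    (hν : ValidParam l₃ ν) (hμ : ValidParam l₃ μ) :
    rho C₁ C₂ ν < rho C₁ C₂ μ ↔ 0 < cross ν μ := by
  have he1 := pencilEcc_sq_lt_one hC.lt₁₂ hC.lt₂₃
  rw [hC.rho_eq hν, hC.rho_eq hμ, div_lt_div_iff_of_pos_right (by linarith [ellipticK_pos he1]),
    ← omega_lt_omega_iff hν hμ (hC.lt₂₃.trans hC.lt₁₂)]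
  exact (strictMono_ellipticF he1).lt_iff_lt

end Poncelet

theorem mainTheorem4
    (C₁ C₂ : Matrix (Fin 3) (Fin 3) ℝ) (l₁ l₂ l₃ : ℝ)
    (hC : Poncelet.StandingAssumptions C₁ C₂ l₁ l₂ l₃)
    (ν μ : ℝ × ℝ) (hν : Poncelet.ValidParam l₃ ν) (hμ : Poncelet.ValidParam l₃ μ) :
    (Poncelet.rho C₁ C₂ ν =
        Poncelet.ellipticF (Poncelet.omega l₁ l₃ ν) (Poncelet.pencilEcc l₁ l₂ l₃) /
          (2 * Poncelet.ellipticK (Poncelet.pencilEcc l₁ l₂ l₃))) ∧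
    (Poncelet.rho C₁ C₂ μ =
        Poncelet.ellipticF (Poncelet.omega l₁ l₃ μ) (Poncelet.pencilEcc l₁ l₂ l₃) /
          (2 * Poncelet.ellipticK (Poncelet.pencilEcc l₁ l₂ l₃))) ∧
    List.TFAE [
      Poncelet.conic (Poncelet.pencil C₁ C₂ μ) ⊆ Poncelet.conicInt (Poncelet.pencil C₁ C₂ ν),
      0 < Poncelet.cross ν μ,
      Poncelet.rho C₁ C₂ ν < Poncelet.rho C₁ C₂ μ] := by
  refine ⟨hC.rho_eq hν, hC.rho_eq hμ, ?_⟩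
  tfae_have 1 ↔ 2 := hC.conic_subset_conicInt_iff hμ
  tfae_have 3 ↔ 2 := hC.rho_lt_rho_iff hν hμ
  tfae_finish
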